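/- Let $\Lambda=\mathbb Z[t^{\pm1}]$. For a diagram $D$ of an oriented link $L$, let $A(D)$ be the set of arcs (the components of $L$ cut at the underpasses; a component without underpasses is a single arc) and $C(D)$ the set of crossings. For $c\in C(D)$ let $a(c)$ be the overpassing arc, and let $b_1(c)$ and $b_2(c)$ be the underpassing arcs on the right and on the left of $a(c)$, respectively. The medial quandle $\mathrm{MQ}(L)$ is the medial quandle (that is, quandle satisfying $(w\triangleright x)\triangleright(y\triangleright z)=(w\triangleright y)\triangleright(x\triangleright z)$) with a generator $q_a$ for each $a\in A(D)$ and a relation $q_{b_1(c)}\triangleright q_{a(c)}=q_{b_2(c)}$ for each $c\in C(D)$. The reduced Alexander module $M_A^{\mathrm{red}}(L)$ is the cokernel of the $\Lambda$-linear map $\Lambda^{C(D)}\to\Lambda^{A(D)}$, $c\mapsto(1-t)\,a(c)+t\,b_1(c)-b_2(c)$, and the reduced Alexander invariant of $L$ is the kernel of the $\Lambda$-linear map $\phi_L^{\mathrm{red}}:M_A^{\mathrm{red}}(L)\to\Lambda$ that sends the generator of every arc to $1$. Theorem. Let $L$ and $L'$ be classical oriented 2-component links, given by diagrams without virtual crossings.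 Then the quandles $\mathrm{MQ}(L)$ and $\mathrm{MQ}(L')$ are isomorphic if and only if the $\Lambda$-modules $\ker\phi_L^{\mathrm{red}}$ and $\ker\phi_{L'}^{\mathrm{red}}$ are isomorphic. -/

import Mathlib

open scoped LaurentPolynomial Quandles

/-! ### Medial quandles given by generators and relations

We use Mathlib's quandles, whose operation `x ◃ y` is the action of `x` on `y`; it corresponds to
`y ▷ x` in the right-handed notation. A quandle is medial when
`(w ▷ x) ▷ (y ▷ z) = (w ▷ y) ▷ (x ▷ z)`, which is Mathlib's `Rack.IsAbelian`. -/

/-- Formal words in the two quandle operations. -/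
inductive QuandleWord (A : Type) : Type
  | gen (a : A) : QuandleWord A
  | act (x y : QuandleWord A) : QuandleWord A
  | invAct (x y : QuandleWord A) : QuandleWord A

/-- The smallest congruence on words that contains the axioms of a medial quandle and the relations
`a ◃ b = b'` for all generators with `R a b b'`. -/
inductive MedialRel {A : Type} (R : A → A → A → Prop) : QuandleWord A → QuandleWord A → Prop
  | refl (x) : MedialRel R x x
  | symm {x y} : MedialRel R x y → MedialRel R y x
  | trans {x y z} : MedialRel R x y → MedialRel R y z → MedialRel R x z
  | act_congr {x x' y y'} : MedialRel R x x' → MedialRel R y y' →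
      MedialRel R (.act x y) (.act x' y')
  | invAct_congr {x x' y y'} : MedialRel R x x' → MedialRel R y y' →
      MedialRel R (.invAct x y) (.invAct x' y')
  | self_distrib (x y z) : MedialRel R (.act x (.act y z)) (.act (.act x y) (.act x z))
  | left_inv (x y) : MedialRel R (.invAct x (.act x y)) y
  | right_inv (x y) : MedialRel R (.act x (.invAct x y)) y
  | fix (x) : MedialRel R (.act x x) x
  | medial (x y z w) :
      MedialRel R (.act (.act x y) (.act z w)) (.act (.act x z) (.act y w))
  | rel {a b b'} : R a b b' → MedialRel R (.act (.gen a) (.gen b)) (.gen b')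

/-- The congruence `MedialRel R` as a setoid. -/
def medialSetoid {A : Type} (R : A → A → A → Prop) : Setoid (QuandleWord A) where
  r := MedialRel R
  iseqv := ⟨.refl, .symm, .trans⟩

/-- The medial quandle generated by `A` subject to the relations `a ◃ b = b'` for `R a b b'`. -/
def PresentedMedialQuandle {A : Type} (R : A → A → A → Prop) : Type :=
  Quotient (medialSetoid R)

instance {A : Type} (R : A → A → A → Prop) : Quandle (PresentedMedialQuandle R) where
  act := Quotient.map₂ .act fun _ _ h _ _ h' => MedialRel.act_congr h h'
  invAct := Quotient.map₂ .invAct fun _ _ h _ _ h' => MedialRel.invAct_congr h h'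
  self_distrib {x y z} := Quotient.inductionOn₃ x y z fun x y z =>
    Quotient.sound (MedialRel.self_distrib x y z)
  left_inv x y := Quotient.inductionOn₂ x y fun x y => Quotient.sound (MedialRel.left_inv x y)
  right_inv x y := Quotient.inductionOn₂ x y fun x y => Quotient.sound (MedialRel.right_inv x y)
  fix {x} := Quotient.inductionOn x fun x => Quotient.sound (MedialRel.fix x)

/-! ### Link diagrams -/

/-- A passage of a link diagram through a classical crossing, on the upper or the lower strand. -/
inductive Passage (C : Type) : Type
  | over (c : C) : Passage C
  | under (c : C) : Passage C

/-- A half-edge of a link diagram at a crossing: the half-edge along which a strand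
enters the crossing or leaves it. -/
inductive HalfEdge (C : Type) : Type
  | enter (p : Passage C) : HalfEdge C
  | leave (p : Passage C) : HalfEdge C

/-- An oriented virtual link diagram up to detour moves, recorded as a signed Gauss diagram.
Every crossing is passed twice, once over and once under; following the orientation of the link,
one comes from the passage `p` to the passage `next p`. Components without classical crossings are
counted separately. A crossing is positive if the lower strand crosses from the right to the left
of the upper strand, and negative otherwise. -/
structure LinkDiagram where
  Crossing : Type
  [fintypeCrossing : Fintype Crossing]
  next : Equiv.Perm (Passage Crossing)
  positive : Crossing → Bool
  numFreeCircles : ℕ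

namespace LinkDiagram

variable (D : LinkDiagram)

/-- The components: the cycles of `next`, and the circles without classical crossings. -/
def Component : Type :=
  Quotient (Equiv.Perm.SameCycle.setoid D.next) ⊕ Fin D.numFreeCircles

/-- The edge that leaves the passage `p` and the edge that leaves the passage `next p` belong to
the same arc if `next p` is an overpass. -/
inductive Continues : Passage D.Crossing → Passage D.Crossing → Prop
  | mk (p : Passage D.Crossing) (c : D.Crossing) (h : D.next p = .over c) : Continues p (.over c)

/-- The arcs of the diagram, obtained by cutting the components at the underpasses. An edge is named
by the passage that it leaves. -/
def Arc : Type := Quot D.Continues ⊕ Fin D.numFreeCircles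

/-- The arc that contains the edge leaving the passage `p`. -/
def arcAfter (p : Passage D.Crossing) : D.Arc := .inl (Quot.mk _ p)

/-- The overpassing arc at a crossing. -/
def overArc (c : D.Crossing) : D.Arc := D.arcAfter (.over c)

/-- The underpassing arc on which one arrives at a crossing. -/
def underIn (c : D.Crossing) : D.Arc := D.arcAfter (D.next.symm (.under c))

/-- The underpassing arc on which one leaves a crossing. -/
def underOut (c : D.Crossing) : D.Arc := D.arcAfter (.under c)

/-- The underpassing arc on the right of the overpassing arc. -/
def rightArc (c : D.Crossing) : D.Arc := if D.positive c then D.underIn c else D.underOut c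

/-- The underpassing arc on the left of the overpassing arc. -/
def leftArc (c : D.Crossing) : D.Arc := if D.positive c then D.underOut c else D.underIn c

/-! #### Classical diagrams -/

/-- The half-edge that follows counterclockwise around the crossing. -/
def ccw : HalfEdge D.Crossing → HalfEdge D.Crossing
  | .leave (.over c) => if D.positive c then .leave (.under c) else .enter (.under c)
  | .enter (.over c) => if D.positive c then .enter (.under c) else .leave (.under c)
  | .leave (.under c) => if D.positive c then .enter (.over c) else .leave (.over c)
  | .enter (.under c) => if D.positive c then .leave (.over c) else .enter (.over c)

/-- The half-edge that follows clockwise around the crossing. -/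
def cw : HalfEdge D.Crossing → HalfEdge D.Crossing
  | .leave (.over c) => if D.positive c then .enter (.under c) else .leave (.under c)
  | .enter (.over c) => if D.positive c then .leave (.under c) else .enter (.under c)
  | .leave (.under c) => if D.positive c then .leave (.over c) else .enter (.over c)
  | .enter (.under c) => if D.positive c then .enter (.over c) else .leave (.over c)

/-- Counterclockwise rotation of the half-edges around the crossings. -/
def rotation : Equiv.Perm (HalfEdge D.Crossing) where
  toFun := D.ccw
  invFun := D.cw
  left_inv := by
    rintro ((c | c) | (c | c)) <;> cases h : D.positive c <;> simp [ccw, cw, h]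
  right_inv := by
    rintro ((c | c) | (c | c)) <;> cases h : D.positive c <;> simp [ccw, cw, h]

/-- The other half of the same edge. -/
def otherHalf : HalfEdge D.Crossing → HalfEdge D.Crossing
  | .leave p => .enter (D.next p)
  | .enter p => .leave (D.next.symm p)

/-- Exchange of the two halves of every edge. -/
def edgeFlip : Equiv.Perm (HalfEdge D.Crossing) where
  toFun := D.otherHalf
  invFun := D.otherHalf
  left_inv := by rintro (p | p) <;> simp [otherHalf]
  right_inv := by rintro (p | p) <;> simp [otherHalf]

/-- The faces of the closed oriented surface on which the diagram is cellularly drawn, given as the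
closed walks around them. -/
def Face : Type :=
  Quotient (Equiv.Perm.SameCycle.setoid (D.rotation * D.edgeFlip))

/-- The connected pieces of the 4-valent graph formed by the crossings and the edges. -/
def Piece : Type :=
  MulAction.orbitRel.Quotient
    (Subgroup.closure {D.rotation, D.edgeFlip}) (HalfEdge D.Crossing)

/-- The diagram is classical: it can be drawn in the plane without virtual crossings. This is
Euler's formula `V - E + F = 2 k` with `k` the number of connected pieces; as
`V - E + F ≤ 2` on every piece, it says that every piece has genus zero. -/
def IsClassical : Prop :=
  (Nat.card D.Crossing : ℤ) - Nat.card (Passage D.Crossing) + Nat.card D.Face =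
    2 * Nat.card D.Piece

/-! #### The invariants -/

/-- The relations `b₁(c) ▷ a(c) = b₂(c)`, that is, `a(c) ◃ b₁(c) = b₂(c)`, for the crossings `c`,
where `a(c)` is the overpassing arc, `b₁(c)` the arc on its right and `b₂(c)` the arc on its
left. -/
inductive CrossingRel : D.Arc → D.Arc → D.Arc → Prop
  | mk (c : D.Crossing) : CrossingRel (D.overArc c) (D.rightArc c) (D.leftArc c)

/-- The medial quandle of a link. -/
abbrev MedialQuandle : Type := PresentedMedialQuandle D.CrossingRel

/-- The element `(1 - t) a(c) + t b₁(c) - b₂(c)` of the free `ℤ[t, t⁻¹]`-module on the arcs. -/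
noncomputable def relator (c : D.Crossing) : D.Arc →₀ ℤ[T;T⁻¹] :=
  Finsupp.single (D.overArc c) (1 - LaurentPolynomial.T 1) +
    Finsupp.single (D.rightArc c) (LaurentPolynomial.T 1) - Finsupp.single (D.leftArc c) 1

/-- The `ℤ[t, t⁻¹]`-linear map with the crossing relators as its values on the basis. -/
noncomputable def reducedRho : (D.Crossing →₀ ℤ[T;T⁻¹]) →ₗ[ℤ[T;T⁻¹]] (D.Arc →₀ ℤ[T;T⁻¹]) :=
  Finsupp.linearCombination ℤ[T;T⁻¹] D.relator

/-- The reduced Alexander module. -/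
abbrev ReducedAlexanderModule : Type :=
  (D.Arc →₀ ℤ[T;T⁻¹]) ⧸ LinearMap.range D.reducedRho

/-- The reduced Crowell map, which sends the generator of every arc to `1`. -/
noncomputable def reducedCrowellMap : D.ReducedAlexanderModule →ₗ[ℤ[T;T⁻¹]] ℤ[T;T⁻¹] :=
  (LinearMap.range D.reducedRho).liftQ
    (Finsupp.linearCombination ℤ[T;T⁻¹] fun _ : D.Arc => (1 : ℤ[T;T⁻¹])) (by
      rw [LinearMap.range_le_ker_iff]
      ext c
      simp [reducedRho, relator])

/-- The reduced Alexander invariant. -/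
noncomputable abbrev ReducedAlexanderInvariant :
    Submodule ℤ[T;T⁻¹] D.ReducedAlexanderModule :=
  LinearMap.ker D.reducedCrowellMap

end LinkDiagram

/-!
The map `q_a ↦ a` sends the medial quandle of a link to the Alexander quandle of its reduced
Alexander module, and the displacements `x ◃ (y ◃⁻¹ ·)` define an action of the reduced Alexander
invariant `K` on the medial quandle, in which the element `m` corresponds to the translation by
`(1 - t) m`. An isomorphism of medial quandles extends to the Alexander modules and restricts to the
invariants. For the converse, the orbits of the action correspond to the components, so the map to
the module is injective as soon as every element killed by `1 - t` fixes all arcs. Such elements are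
integral combinations of the longitudes, and the longitude of a component fixes the arcs of this
component. An Alexander numbering, which every classical diagram has by Euler's formula, gives a
linear relation between the crossing relators, from which it follows that the longitudes add up to
zero. Hence for two components each longitude fixes all arcs, and the differences `x - b` with a
fixed arc `b` identify the medial quandle with the union of the two cosets `(1 - t) K` and
`d + (1 - t) K`, where `d = a - b` for an arc `a` of the other component. As `d` generates the
infinite cyclic group `K / (1 - t) K`, an isomorphism of the invariants matches the cosets after a
change of sign if necessary.
-/

open LaurentPolynomial Rack

/-! ### Laurent polynomials at `t = 1` -/

section Augmentation

variable {R : Type*} [CommRing R]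

/-- The augmentation `t ↦ 1` of the Laurent polynomials. -/
noncomputable def augmentation : R[T;T⁻¹] →+* R := eval₂ (RingHom.id R) 1

@[simp]
theorem augmentation_T (n : ℤ) : augmentation (T n : R[T;T⁻¹]) = 1 := by simp [augmentation]

@[simp]
theorem augmentation_C (r : R) : augmentation (C r) = r := by simp [augmentation]

theorem one_sub_T_one_dvd_one_sub_T (n : ℤ) : (1 - T 1 : R[T;T⁻¹]) ∣ 1 - T n := by
  induction n using Int.induction_on with
  | zero => simp
  | succ n ih =>
    have h : (1 - T (n + 1) : R[T;T⁻¹]) = (1 - T n) + T n * (1 - T 1) := by rw [T_add]; ring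
    exact h ▸ dvd_add ih (dvd_mul_left _ _)
  | pred n ih =>
    have h : (1 - T (-n - 1) : R[T;T⁻¹]) = (1 - T (-n)) - T (-n - 1) * (1 - T 1) := by
      rw [mul_sub, ← T_add, sub_add_cancel]; ring
    exact h ▸ dvd_sub ih (dvd_mul_left _ _)

theorem one_sub_T_one_dvd_sub_C_augmentation (p : R[T;T⁻¹]) :
    (1 - T 1 : R[T;T⁻¹]) ∣ p - C (augmentation p) := by
  induction p using LaurentPolynomial.induction_on' with
  | add p q hp hq =>
    simpa only [map_add, add_sub_add_comm] using dvd_add hp hq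
  | C_mul_T n a =>
    have h : C a * T n - C (augmentation (C a * T n)) = -C a * (1 - T n : R[T;T⁻¹]) := by
      simp only [map_mul, augmentation_C, augmentation_T, map_one]; ring
    exact h ▸ (one_sub_T_one_dvd_one_sub_T n).mul_left _

theorem one_sub_T_one_ne_zero [Nontrivial R] : (1 - T 1 : R[T;T⁻¹]) ≠ 0 := fun h => by
  simpa using congrArg (fun p : R[T;T⁻¹] => p.coeff 0) h

end Augmentation

theorem exists_eq_augmentation_zsmul_add {M : Type*} [AddCommGroup M] [Module ℤ[T;T⁻¹] M]
    (p : ℤ[T;T⁻¹]) (m : M) : ∃ n : M, p • m = augmentation p • m + (1 - T 1 : ℤ[T;T⁻¹]) • n := by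
  obtain ⟨q, hq⟩ := one_sub_T_one_dvd_sub_C_augmentation p
  refine ⟨q • m, ?_⟩
  rw [smul_smul, ← hq, sub_smul, eq_intCast C, Int.cast_smul_eq_zsmul, add_sub_cancel]

/-- The module over the Laurent polynomials in which `t` acts by a given automorphism. -/
noncomputable abbrev laurentModule {M : Type*} [AddCommGroup M] (u : M ≃+ M) :
    Module ℤ[T;T⁻¹] M :=
  let unit : (AddMonoid.End M)ˣ :=
    ⟨u.toAddMonoidHom, u.symm.toAddMonoidHom, AddMonoidHom.ext u.apply_symm_apply,
      AddMonoidHom.ext u.symm_apply_apply⟩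
  Module.compHom M (AddMonoidAlgebra.lift ℤ (AddMonoid.End M) ℤ
    ((Units.coeHom _).comp (zpowersHom _ unit))).toRingHom

theorem laurentModule_T_one_smul {M : Type*} [AddCommGroup M] (u : M ≃+ M) (m : M) :
    letI := laurentModule u
    (T 1 : ℤ[T;T⁻¹]) • m = u m := by
  change AddMonoidAlgebra.lift ℤ (AddMonoid.End M) ℤ _ (T 1) m = u m
  rw [T, AddMonoidAlgebra.lift_single, one_smul, MonoidHom.comp_apply, zpowersHom_apply,
    toAdd_ofAdd, zpow_one]
  rfl

section

variable {M N : Type*} [AddCommGroup M] [AddCommGroup N] [Module ℤ[T;T⁻¹] M] [Module ℤ[T;T⁻¹] N]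

theorem T_one_smul_T_neg_one_smul (m : M) :
    (T 1 : ℤ[T;T⁻¹]) • (T (-1) : ℤ[T;T⁻¹]) • m = m := by
  rw [smul_smul, ← T_add, add_neg_cancel, T_zero, one_smul]

theorem T_neg_one_smul_T_one_smul (m : M) :
    (T (-1) : ℤ[T;T⁻¹]) • (T 1 : ℤ[T;T⁻¹]) • m = m := by
  rw [smul_smul, ← T_add, neg_add_cancel, T_zero, one_smul]

theorem map_laurent_smul (f : M →+ N)
    (hf : ∀ m, f ((T 1 : ℤ[T;T⁻¹]) • m) = (T 1 : ℤ[T;T⁻¹]) • f m) (p : ℤ[T;T⁻¹]) (m : M) :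
    f (p • m) = p • f m := by
  have map_T_neg_one_smul (m : M) :
      f ((T (-1) : ℤ[T;T⁻¹]) • m) = (T (-1) : ℤ[T;T⁻¹]) • f m := by
    rw [← T_neg_one_smul_T_one_smul (f _), ← hf, T_one_smul_T_neg_one_smul]
  have map_T_smul (n : ℤ) (m : M) : f ((T n : ℤ[T;T⁻¹]) • m) = (T n : ℤ[T;T⁻¹]) • f m := by
    induction n using Int.induction_on generalizing m with
    | zero => simp only [T_zero, one_smul]
    | succ n ih => rw [T_add, mul_smul, mul_smul, ih, hf]
    | pred n ih => rw [sub_eq_add_neg, T_add, mul_smul, mul_smul, ih, map_T_neg_one_smul]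
  induction p using LaurentPolynomial.induction_on' with
  | add p q hp hq => rw [add_smul, add_smul, map_add, hp, hq]
  | C_mul_T n a =>
    rw [mul_smul, mul_smul, eq_intCast (C : ℤ →+* ℤ[T;T⁻¹]) a, Int.cast_smul_eq_zsmul,
      Int.cast_smul_eq_zsmul, map_zsmul, map_T_smul]

end

/-! ### The displacement group of a medial quandle -/

section DisplacementGroup

variable {Q : Type*} [Rack Q]

/-- The group generated by the displacements `z ↦ x ◃ (y ◃⁻¹ z)` of a rack. -/
def displacementGroup (Q : Type*) [Rack Q] : Subgroup (Equiv.Perm Q) :=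
  Subgroup.closure {g | ∃ x y : Q, act' x * (act' y)⁻¹ = g}

theorem act'_mul_inv_mem_displacementGroup (x y : Q) :
    act' x * (act' y)⁻¹ ∈ displacementGroup Q :=
  Subgroup.subset_closure ⟨x, y, rfl⟩

theorem act'_invAct (x y : Q) : act' (x ◃⁻¹ y) = (act' x)⁻¹ * act' y * act' x := by
  have h := ad_conj x (x ◃⁻¹ y)
  rw [act_invAct_eq] at h
  rw [h]
  group

theorem act'_mem_normalizer_displacementGroup (o : Q) :
    act' o ∈ Subgroup.normalizer (displacementGroup Q : Set (Equiv.Perm Q)) := by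
  refine Subgroup.normalizer_le_normalizer_closure _
    (Subgroup.mem_set_normalizer_iff.mpr fun g => ⟨?_, ?_⟩)
  · rintro ⟨x, y, rfl⟩
    exact ⟨o ◃ x, o ◃ y, by rw [ad_conj, ad_conj]; group⟩
  · rintro ⟨x, y, hxy⟩
    refine ⟨o ◃⁻¹ x, o ◃⁻¹ y, ?_⟩
    rw [act'_invAct, act'_invAct, ← mul_right_inj (act' o), ← mul_left_inj (act' o)⁻¹, ← hxy]
    group

theorem act'_mul_inv_mul_swap (h : IsAbelian Q) (x y z : Q) :
    act' y * (act' x)⁻¹ * act' z = act' z * (act' x)⁻¹ * act' y := by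
  have h' : act' (x ◃ y) * act' z = act' (x ◃ z) * act' y := Equiv.ext fun w => h x y z w
  rw [ad_conj, ad_conj] at h'
  simpa only [mul_assoc, mul_right_inj] using h'

theorem commute_act'_mul_inv (h : IsAbelian Q) (a b c d : Q) :
    Commute (act' a * (act' b)⁻¹) (act' c * (act' d)⁻¹) := by
  have swap_inv : (act' b)⁻¹ * act' a * (act' d)⁻¹ = (act' d)⁻¹ * act' a * (act' b)⁻¹ := by
    simpa only [mul_inv_rev, inv_inv, ← mul_assoc] using
      congrArg (·⁻¹) (act'_mul_inv_mul_swap h a d b)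
  calc act' a * (act' b)⁻¹ * (act' c * (act' d)⁻¹)
      = act' a * (act' b)⁻¹ * act' c * (act' d)⁻¹ := by group
    _ = act' c * ((act' b)⁻¹ * act' a * (act' d)⁻¹) := by
      rw [act'_mul_inv_mul_swap h]; group
    _ = act' c * (act' d)⁻¹ * (act' a * (act' b)⁻¹) := by rw [swap_inv]; group

theorem isMulCommutative_displacementGroup (h : IsAbelian Q) :
    IsMulCommutative (displacementGroup Q) :=
  Subgroup.isMulCommutative_closure (by
    rintro _ ⟨a, b, rfl⟩ _ ⟨c, d, rfl⟩
    exact commute_act'_mul_inv h a b c d)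

end DisplacementGroup

/-- The displacement group of a medial rack as an additive group. It is a module over the Laurent
polynomials, in which `t` acts by conjugation with the action of the base point `o`. -/
def Displacement {Q : Type*} [Rack Q] (_h : IsAbelian Q) (_o : Q) : Type _ :=
  Additive (displacementGroup Q)

namespace Displacement

variable {Q : Type*} [Rack Q] {h : IsAbelian Q} {o : Q}

instance : AddCommGroup (Displacement h o) where
  __ := (inferInstance : AddGroup (Additive (displacementGroup Q)))
  add_comm := (isMulCommutative_displacementGroup h).is_comm.comm

instance : AddAction (Displacement h o) Q :=
  inferInstanceAs (AddAction (Additive (displacementGroup Q)) Q)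

noncomputable instance : Module ℤ[T;T⁻¹] (Displacement h o) :=
  laurentModule ((displacementGroup Q).normalizerMonoidHom
    ⟨act' o, act'_mem_normalizer_displacementGroup o⟩).toAdditive

theorem T_one_smul_vadd (d : Displacement h o) (x : Q) :
    (T 1 : ℤ[T;T⁻¹]) • d +ᵥ x = o ◃ (d +ᵥ (o ◃⁻¹ x)) :=
  congrArg (· +ᵥ x) (laurentModule_T_one_smul _ d)

@[ext]
theorem ext {d e : Displacement h o} (hde : ∀ x : Q, d +ᵥ x = e +ᵥ x) : d = e :=
  Subtype.ext (Equiv.ext hde)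

variable (h o) in
/-- The displacement `z ↦ x ◃ (o ◃⁻¹ z)`, which moves the base point `o` of a quandle to
`x ◃ o`. -/
def ofElement (x : Q) : Displacement h o :=
  Additive.ofMul ⟨_, act'_mul_inv_mem_displacementGroup x o⟩

theorem ofElement_vadd (x z : Q) : ofElement h o x +ᵥ z = x ◃ (o ◃⁻¹ z) := rfl

theorem neg_ofElement_vadd (x z : Q) : -ofElement h o x +ᵥ z = o ◃ (x ◃⁻¹ z) := by
  rw [neg_vadd_eq_iff, ofElement_vadd, invAct_act_eq, act_invAct_eq]

end Displacement

/-! ### Alexander quandles -/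

/-- A map from a rack to a module over the Laurent polynomials that turns `x ◃ y` into
`(1 - t) x + t y`, the operation of the Alexander quandle of the module. -/
def IsAlexanderMap {Q N : Type*} [Rack Q] [AddCommGroup N] [Module ℤ[T;T⁻¹] N] (g : Q → N) : Prop :=
  ∀ x y, g (x ◃ y) = (1 - T 1 : ℤ[T;T⁻¹]) • g x + (T 1 : ℤ[T;T⁻¹]) • g y

theorem Displacement.isAlexanderMap_ofElement {Q : Type*} [Rack Q] {h : IsAbelian Q} {o : Q} :
    IsAlexanderMap (ofElement h o) := fun x y => by
  have h_add : ofElement h o (x ◃ y) + (T 1 : ℤ[T;T⁻¹]) • ofElement h o x =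
      ofElement h o x + (T 1 : ℤ[T;T⁻¹]) • ofElement h o y := by
    ext z
    simp only [add_vadd, T_one_smul_vadd, ofElement_vadd, invAct_act_eq, ← self_distrib]
  rw [sub_smul, one_smul, sub_add_eq_add_sub, ← h_add, add_sub_cancel_right]

namespace IsAlexanderMap

variable {Q N : Type*} [Rack Q] [AddCommGroup N] [Module ℤ[T;T⁻¹] N] {g : Q → N}

theorem map_invAct (hg : IsAlexanderMap g) (x y : Q) :
    g (x ◃⁻¹ y) = (T (-1) : ℤ[T;T⁻¹]) • (g y - (1 - T 1 : ℤ[T;T⁻¹]) • g x) := by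
  have h := hg x (x ◃⁻¹ y)
  rw [act_invAct_eq] at h
  rw [h, add_sub_cancel_left, T_neg_one_smul_T_one_smul]

theorem map_act_invAct (hg : IsAlexanderMap g) (x y z : Q) :
    g (x ◃ (y ◃⁻¹ z)) = g z + (1 - T 1 : ℤ[T;T⁻¹]) • (g x - g y) := by
  rw [hg, hg.map_invAct, T_one_smul_T_neg_one_smul]
  module

theorem linearMap_comp {N' : Type*} [AddCommGroup N'] [Module ℤ[T;T⁻¹] N'] (hg : IsAlexanderMap g)
    (f : N →ₗ[ℤ[T;T⁻¹]] N') : IsAlexanderMap (f ∘ g) := fun x y => by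
  simp only [Function.comp_apply, hg x y, map_add, map_smul]

theorem comp_shelfHom {Q' : Type*} [Rack Q'] (hg : IsAlexanderMap g) (f : Q' →◃ Q) :
    IsAlexanderMap (g ∘ f) := fun x y => by
  simp only [Function.comp_apply, ShelfHom.map_act, hg (f x) (f y)]

theorem sub_const (hg : IsAlexanderMap g) (n : N) : IsAlexanderMap fun x => g x - n :=
  fun x y => by
    simp only [hg x y]
    module

variable {h : IsAbelian Q} {o : Q}

theorem exists_map_vadd_eq (hg : IsAlexanderMap g) (d : Displacement h o) :
    ∃ n, ∀ z, g (d +ᵥ z) = g z + n := by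
  suffices H : ∀ u ∈ displacementGroup Q, ∃ n, ∀ z, g (u z) = g z + n from H _ d.toMul.2
  intro u hu
  induction hu using Subgroup.closure_induction with
  | mem _ hxy =>
    obtain ⟨x, y, rfl⟩ := hxy
    exact ⟨_, hg.map_act_invAct x y⟩
  | one => exact ⟨0, fun z => (add_zero _).symm⟩
  | mul u v _ _ hu hv =>
    obtain ⟨m, hm⟩ := hu
    obtain ⟨n, hn⟩ := hv
    exact ⟨n + m, fun z => by rw [Equiv.Perm.mul_apply, hm, hn, add_assoc]⟩
  | inv u _ hu =>
    obtain ⟨n, hn⟩ := hu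
    exact ⟨-n, fun z => by
      rw [← sub_eq_add_neg, eq_sub_iff_add_eq, ← hn]
      exact congrArg g (u.apply_symm_apply z)⟩

/-- A displacement moves the values of an Alexander map by a fixed vector. -/
noncomputable def translation (hg : IsAlexanderMap g) :
    Displacement h o →ₗ[ℤ[T;T⁻¹]] N :=
  letI F : Displacement h o →+ N :=
    AddMonoidHom.mk' (fun d => g (d +ᵥ o) - g o) fun d e => by
      obtain ⟨m, hm⟩ := hg.exists_map_vadd_eq d
      simp only [add_vadd, hm, add_sub_cancel_left]
      abel
  { F with
    map_smul' := map_laurent_smul F fun d => by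
      obtain ⟨m, hm⟩ := hg.exists_map_vadd_eq d
      simp only [F, AddMonoidHom.mk'_apply, Displacement.T_one_smul_vadd, hm, hg o, hg.map_invAct,
        smul_add, T_one_smul_T_neg_one_smul]
      module }

theorem map_vadd (hg : IsAlexanderMap g) (d : Displacement h o) (z : Q) :
    g (d +ᵥ z) = g z + hg.translation d := by
  obtain ⟨n, hn⟩ := hg.exists_map_vadd_eq d
  have translation_eq : hg.translation d = n := sub_eq_of_eq_add' (hn o)
  rw [hn, translation_eq]

theorem translation_ofElement (hg : IsAlexanderMap g) (x : Q) :
    hg.translation (Displacement.ofElement h o x) =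
      (1 - T 1 : ℤ[T;T⁻¹]) • (g x - g o) := by
  rw [← add_right_inj (g o), ← hg.map_vadd, Displacement.ofElement_vadd, hg.map_act_invAct]

end IsAlexanderMap

section

variable {Q Q' N N' : Type*} [Rack Q] [Rack Q'] [AddCommGroup N] [Module ℤ[T;T⁻¹] N]
  [AddCommGroup N'] [Module ℤ[T;T⁻¹] N'] {g : Q → N} {g' : Q' → N'}

theorem exists_inverse_shelfHom (f : Q →◃ Q') (hf : Function.Bijective f) :
    ∃ f' : Q' →◃ Q, (∀ x, f' (f x) = x) ∧ ∀ y, f (f' y) = y := by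
  let e := Equiv.ofBijective f hf
  refine ⟨⟨e.symm, fun {x y} => hf.1 ?_⟩, e.symm_apply_apply, e.apply_symm_apply⟩
  rw [f.map_act]
  exact (e.apply_symm_apply _).trans
    (congrArg₂ _ (e.apply_symm_apply x).symm (e.apply_symm_apply y).symm)

theorem exists_bijective_shelfHom_of_image_range_eq (hg : IsAlexanderMap g)
    (hg' : IsAlexanderMap g') (hg_inj : Function.Injective g) (hg'_inj : Function.Injective g')
    (f : N ≃ₗ[ℤ[T;T⁻¹]] N') (hf : f '' Set.range g = Set.range g') :
    ∃ φ : Q →◃ Q', Function.Bijective φ := by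
  have exists_apply_eq (x : Q) : ∃ y, g' y = f (g x) :=
    hf.subset ⟨g x, ⟨x, rfl⟩, rfl⟩
  choose φ hφ using exists_apply_eq
  refine ⟨⟨φ, fun {x y} => hg'_inj ?_⟩, fun x y hxy => hg_inj (f.injective ?_), fun y => ?_⟩
  · rw [hφ, hg, hg', hφ, hφ, map_add, map_smul, map_smul]
  · rw [← hφ, ← hφ]
    exact congrArg g' hxy
  · obtain ⟨_, ⟨x, rfl⟩, hx⟩ := hf.superset ⟨y, rfl⟩
    exact ⟨x, hg'_inj ((hφ x).trans hx)⟩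

end

/-- The Alexander quandle of a module over the Laurent polynomials. -/
noncomputable abbrev alexanderQuandle (N : Type*) [AddCommGroup N] [Module ℤ[T;T⁻¹] N] :
    Quandle N where
  act x y := (1 - T 1 : ℤ[T;T⁻¹]) • x + (T 1 : ℤ[T;T⁻¹]) • y
  self_distrib := by intros; module
  invAct x y := (T (-1) : ℤ[T;T⁻¹]) • (y - (1 - T 1 : ℤ[T;T⁻¹]) • x)
  left_inv x y := by simp only [add_sub_cancel_left, T_neg_one_smul_T_one_smul]
  right_inv x y := by simp only [T_one_smul_T_neg_one_smul, add_sub_cancel]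
  fix := by intros; module

theorem isAbelian_alexanderQuandle (N : Type*) [AddCommGroup N] [Module ℤ[T;T⁻¹] N] :
    letI := alexanderQuandle N
    IsAbelian N := fun x y z w => by
  change (1 - T 1 : ℤ[T;T⁻¹]) • ((1 - T 1 : ℤ[T;T⁻¹]) • x + (T 1 : ℤ[T;T⁻¹]) • y) +
      (T 1 : ℤ[T;T⁻¹]) • ((1 - T 1 : ℤ[T;T⁻¹]) • z + (T 1 : ℤ[T;T⁻¹]) • w) =
    (1 - T 1 : ℤ[T;T⁻¹]) • ((1 - T 1 : ℤ[T;T⁻¹]) • x + (T 1 : ℤ[T;T⁻¹]) • z) +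
      (T 1 : ℤ[T;T⁻¹]) • ((1 - T 1 : ℤ[T;T⁻¹]) • y + (T 1 : ℤ[T;T⁻¹]) • w)
  module

namespace PresentedMedialQuandle

variable {A : Type} {R : A → A → A → Prop}

/-- The generators of a presented medial quandle. -/
def of (a : A) : PresentedMedialQuandle R := Quotient.mk _ (.gen a)

theorem isAbelian : IsAbelian (PresentedMedialQuandle R) := fun x y z w =>
  Quotient.inductionOn₂ x y fun x y => Quotient.inductionOn₂ z w fun z w =>
    Quotient.sound (MedialRel.medial x y z w)

theorem of_act_of {a b b' : A} (h : R a b b') :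
    (of a : PresentedMedialQuandle R) ◃ of b = of b' :=
  Quotient.sound (MedialRel.rel h)

theorem induction {P : PresentedMedialQuandle R → Prop} (gen : ∀ a, P (of a))
    (act : ∀ x y, P x → P y → P (x ◃ y)) (invAct : ∀ x y, P x → P y → P (x ◃⁻¹ y))
    (x : PresentedMedialQuandle R) : P x := by
  refine Quotient.inductionOn x fun w => ?_
  induction w with
  | gen a => exact gen a
  | act x y hx hy => exact act _ _ hx hy
  | invAct x y hx hy => exact invAct _ _ hx hy

theorem alexanderMap_ext {N : Type*} [AddCommGroup N] [Module ℤ[T;T⁻¹] N]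
    {g g' : PresentedMedialQuandle R → N} (hg : IsAlexanderMap g) (hg' : IsAlexanderMap g')
    (h : ∀ a, g (of a) = g' (of a)) : g = g' := by
  ext x
  induction x using PresentedMedialQuandle.induction with
  | gen a => exact h a
  | act x y hx hy => rw [hg, hg', hx, hy]
  | invAct x y hx hy => rw [hg.map_invAct, hg'.map_invAct, hx, hy]

end PresentedMedialQuandle

/-- The value of a word when its letters are interpreted in a rack. -/
def QuandleWord.eval {A : Type} {Q : Type*} [Rack Q] (f : A → Q) : QuandleWord A → Q
  | .gen a => f a
  | .act x y => x.eval f ◃ y.eval f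
  | .invAct x y => x.eval f ◃⁻¹ y.eval f

theorem MedialRel.eval_eq {A : Type} {R : A → A → A → Prop} {Q : Type*} [Quandle Q]
    (hQ : IsAbelian Q) {f : A → Q} (hf : ∀ a b b', R a b b' → f a ◃ f b = f b')
    {x y : QuandleWord A} (h : MedialRel R x y) : x.eval f = y.eval f := by
  induction h with
  | refl => rfl
  | symm _ ih => exact ih.symm
  | trans _ _ ih ih' => exact ih.trans ih'
  | act_congr _ _ ih ih' => exact congrArg₂ (· ◃ ·) ih ih'
  | invAct_congr _ _ ih ih' => exact congrArg₂ (· ◃⁻¹ ·) ih ih'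
  | self_distrib => exact Shelf.self_distrib
  | left_inv x y => exact Rack.left_inv _ _
  | right_inv x y => exact Rack.right_inv _ _
  | fix => exact Quandle.fix
  | medial => exact hQ _ _ _ _
  | rel h => exact hf _ _ _ h

/-- The universal property of a presented medial quandle. -/
def PresentedMedialQuandle.lift {A : Type} {R : A → A → A → Prop} {Q : Type*} [Quandle Q]
    (hQ : IsAbelian Q) (f : A → Q) (hf : ∀ a b b', R a b b' → f a ◃ f b = f b') :
    PresentedMedialQuandle R →◃ Q where
  toFun := Quotient.lift (QuandleWord.eval f) fun _ _ => MedialRel.eval_eq hQ hf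
  map_act' {x y} := Quotient.inductionOn₂ x y fun _ _ => rfl

/-! ### The reduced Alexander module -/

namespace LinkDiagram

attribute [instance] fintypeCrossing

section AlexanderMap

variable {D : LinkDiagram} {N : Type*} [AddCommGroup N] [Module ℤ[T;T⁻¹] N]

/-- The generator of the medial quandle given by an arc. -/
def arcElement (a : D.Arc) : D.MedialQuandle := PresentedMedialQuandle.of a

/-- The generator of the reduced Alexander module given by an arc. -/
noncomputable def arcClass (a : D.Arc) : D.ReducedAlexanderModule :=
  (LinearMap.range D.reducedRho).mkQ (Finsupp.single a 1)

theorem mkQ_relator (c : D.Crossing) : (LinearMap.range D.reducedRho).mkQ (D.relator c) = 0 := by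
  rw [Submodule.mkQ_apply, Submodule.Quotient.mk_eq_zero]
  exact ⟨Finsupp.single c 1, by simp [reducedRho]⟩

theorem arcClass_leftArc (c : D.Crossing) :
    arcClass (D.leftArc c) = (1 - T 1 : ℤ[T;T⁻¹]) • arcClass (D.overArc c) +
      (T 1 : ℤ[T;T⁻¹]) • arcClass (D.rightArc c) := by
  have h := mkQ_relator c
  rw [relator, map_sub, sub_eq_zero] at h
  rw [arcClass, ← h, arcClass, arcClass, ← map_smul, ← map_smul, ← map_add]
  simp

theorem span_arcClass : Submodule.span ℤ[T;T⁻¹] (Set.range (arcClass (D := D))) = ⊤ := by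
  have h : Set.range (arcClass (D := D)) =
      (LinearMap.range D.reducedRho).mkQ '' Set.range fun a => Finsupp.single a 1 :=
    Set.range_comp _ _
  rw [h, ← Submodule.map_span, ← Finsupp.coe_basisSingleOne, Module.Basis.span_eq,
    Submodule.map_top, Submodule.range_mkQ]

theorem linearMap_ext {f g : D.ReducedAlexanderModule →ₗ[ℤ[T;T⁻¹]] N}
    (h : ∀ a, f (arcClass a) = g (arcClass a)) : f = g :=
  LinearMap.ext_on_range span_arcClass h

/-- The linear map on the reduced Alexander module with given values on the arcs. -/
noncomputable def lift (f : D.Arc → N)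
    (hf : ∀ c, f (D.leftArc c) = (1 - T 1 : ℤ[T;T⁻¹]) • f (D.overArc c) +
      (T 1 : ℤ[T;T⁻¹]) • f (D.rightArc c)) : D.ReducedAlexanderModule →ₗ[ℤ[T;T⁻¹]] N :=
  (LinearMap.range D.reducedRho).liftQ (Finsupp.linearCombination ℤ[T;T⁻¹] f) (by
    rw [LinearMap.range_le_ker_iff]
    ext c
    simp [reducedRho, relator, hf, sub_smul])

@[simp]
theorem lift_arcClass (f : D.Arc → N) (hf) (a : D.Arc) : lift f hf (arcClass a) = f a := by
  simp [lift, arcClass]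

@[simp]
theorem reducedCrowellMap_arcClass (a : D.Arc) : D.reducedCrowellMap (arcClass a) = 1 := by
  simp [reducedCrowellMap, arcClass]

variable (D) in
/-- The map from the medial quandle to the reduced Alexander module that sends the generator of an
arc to its class. -/
noncomputable def alexanderMap : D.MedialQuandle → D.ReducedAlexanderModule :=
  letI := alexanderQuandle D.ReducedAlexanderModule
  PresentedMedialQuandle.lift (isAbelian_alexanderQuandle _) arcClass (by
    rintro _ _ _ ⟨c⟩
    exact (arcClass_leftArc c).symm)

@[simp]
theorem alexanderMap_arcElement (a : D.Arc) : D.alexanderMap (arcElement a) = arcClass a := rfl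

theorem isAlexanderMap_alexanderMap : IsAlexanderMap D.alexanderMap := fun _ _ =>
  letI := alexanderQuandle D.ReducedAlexanderModule
  ShelfHom.map_act (PresentedMedialQuandle.lift _ _ _)

/-- The linear map through which an Alexander map on the medial quandle factors. -/
noncomputable def extend {g : D.MedialQuandle → N} (hg : IsAlexanderMap g) :
    D.ReducedAlexanderModule →ₗ[ℤ[T;T⁻¹]] N :=
  lift (g ∘ arcElement) fun c => by
    rw [Function.comp_apply, arcElement, ← PresentedMedialQuandle.of_act_of (.mk c)]
    exact hg _ _

@[simp]
theorem extend_alexanderMap {g : D.MedialQuandle → N} (hg : IsAlexanderMap g)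
    (x : D.MedialQuandle) : extend hg (D.alexanderMap x) = g x :=
  congrFun (PresentedMedialQuandle.alexanderMap_ext
    (isAlexanderMap_alexanderMap.linearMap_comp (extend hg)) hg fun _ => lift_arcClass _ _ _) x

@[simp]
theorem reducedCrowellMap_alexanderMap (x : D.MedialQuandle) :
    D.reducedCrowellMap (D.alexanderMap x) = 1 :=
  congrFun (PresentedMedialQuandle.alexanderMap_ext
    (isAlexanderMap_alexanderMap.linearMap_comp D.reducedCrowellMap) (g' := fun _ => 1)
    (fun x y => by simp) reducedCrowellMap_arcClass) x

/-- The difference of the classes of two elements of the medial quandle. -/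
noncomputable def alexanderSub (x y : D.MedialQuandle) : D.ReducedAlexanderInvariant :=
  ⟨D.alexanderMap x - D.alexanderMap y, by
    rw [LinearMap.mem_ker, map_sub, reducedCrowellMap_alexanderMap, reducedCrowellMap_alexanderMap,
      sub_self]⟩

@[simp]
theorem coe_alexanderSub (x y : D.MedialQuandle) :
    (alexanderSub x y : D.ReducedAlexanderModule) = D.alexanderMap x - D.alexanderMap y := rfl

end AlexanderMap

theorem nonempty_reducedAlexanderInvariant_equiv {D D' : LinkDiagram}
    (f : D.MedialQuandle →◃ D'.MedialQuandle) (hf : Function.Bijective f) :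
    Nonempty (D.ReducedAlexanderInvariant ≃ₗ[ℤ[T;T⁻¹]] D'.ReducedAlexanderInvariant) := by
  obtain ⟨g, hgf, hfg⟩ := exists_inverse_shelfHom f hf
  let F := extend (isAlexanderMap_alexanderMap.comp_shelfHom f)
  let G := extend (isAlexanderMap_alexanderMap.comp_shelfHom g)
  have hF (x) : F (D.alexanderMap x) = D'.alexanderMap (f x) := extend_alexanderMap _ x
  have hG (x) : G (D'.alexanderMap x) = D.alexanderMap (g x) := extend_alexanderMap _ x
  let E : D.ReducedAlexanderModule ≃ₗ[ℤ[T;T⁻¹]] D'.ReducedAlexanderModule :=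
    LinearEquiv.ofLinearMap F G
      (linearMap_ext fun a => by
        rw [LinearMap.comp_apply, ← alexanderMap_arcElement, hG, hF, hfg, LinearMap.id_apply])
      (linearMap_ext fun a => by
        rw [LinearMap.comp_apply, ← alexanderMap_arcElement, hF, hG, hgf, LinearMap.id_apply])
  have crowell_comp : D'.reducedCrowellMap ∘ₗ E.toLinearMap = D.reducedCrowellMap :=
    linearMap_ext fun a => by
      rw [LinearMap.comp_apply, ← alexanderMap_arcElement]
      exact (congrArg _ (hF _)).trans (by simp)
  refine ⟨E.ofSubmodules _ _ ?_⟩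
  rw [ReducedAlexanderInvariant, ← crowell_comp, LinearMap.ker_comp]
  exact Submodule.map_comap_eq_of_surjective E.surjective _

section Displacement

variable {D : LinkDiagram} (o : D.MedialQuandle)

/-- The action of the reduced Alexander module on the medial quandle by displacements. The action of
the reduced Alexander invariant does not depend on the base point `o`. -/
noncomputable def displacement :
    D.ReducedAlexanderModule →ₗ[ℤ[T;T⁻¹]] Displacement PresentedMedialQuandle.isAbelian o :=
  extend Displacement.isAlexanderMap_ofElement

theorem displacement_alexanderMap (x : D.MedialQuandle) :
    displacement o (D.alexanderMap x) = Displacement.ofElement _ o x :=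
  extend_alexanderMap _ x

theorem displacement_alexanderSub_vadd (x y z : D.MedialQuandle) :
    displacement o (alexanderSub x y) +ᵥ z = x ◃ (y ◃⁻¹ z) := by
  rw [coe_alexanderSub, map_sub, displacement_alexanderMap, displacement_alexanderMap,
    sub_eq_add_neg, add_vadd, Displacement.neg_ofElement_vadd, Displacement.ofElement_vadd,
    invAct_act_eq]

theorem act_eq_displacement_vadd (x y : D.MedialQuandle) :
    x ◃ y = displacement o (alexanderSub x y) +ᵥ y := by
  rw [displacement_alexanderSub_vadd, Quandle.fix_inv]

theorem exists_eq_displacement_vadd_arcElement (x : D.MedialQuandle) :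
    ∃ (a : D.Arc) (m : D.ReducedAlexanderInvariant),
      x = displacement o (m : D.ReducedAlexanderModule) +ᵥ arcElement a := by
  induction x using PresentedMedialQuandle.induction with
  | gen a => exact ⟨a, 0, by simp [arcElement]⟩
  | act x y _ hy =>
    obtain ⟨a, m, hm⟩ := hy
    refine ⟨a, alexanderSub x y + m, ?_⟩
    rw [Submodule.coe_add, map_add, add_vadd, ← hm, ← act_eq_displacement_vadd]
  | invAct x y _ hy =>
    obtain ⟨a, m, hm⟩ := hy
    refine ⟨a, -alexanderSub x (x ◃⁻¹ y) + m, ?_⟩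
    rw [Submodule.coe_add, map_add, add_vadd, ← hm, Submodule.coe_neg, map_neg, eq_neg_vadd_iff,
      ← act_eq_displacement_vadd, act_invAct_eq]

theorem translation_displacement (m : D.ReducedAlexanderModule) :
    isAlexanderMap_alexanderMap.translation (displacement o m) =
      (1 - T 1 : ℤ[T;T⁻¹]) • (m - D.reducedCrowellMap m • D.alexanderMap o) := by
  suffices h : isAlexanderMap_alexanderMap.translation ∘ₗ displacement o =
      (1 - T 1 : ℤ[T;T⁻¹]) • (LinearMap.id - D.reducedCrowellMap.smulRight (D.alexanderMap o)) from
    LinearMap.congr_fun h m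
  refine linearMap_ext fun a => ?_
  rw [LinearMap.comp_apply, ← alexanderMap_arcElement, displacement_alexanderMap,
    isAlexanderMap_alexanderMap.translation_ofElement]
  simp

theorem alexanderMap_displacement_vadd (m : D.ReducedAlexanderInvariant) (z : D.MedialQuandle) :
    D.alexanderMap (displacement o (m : D.ReducedAlexanderModule) +ᵥ z) =
      D.alexanderMap z + (1 - T 1 : ℤ[T;T⁻¹]) • (m : D.ReducedAlexanderModule) := by
  rw [isAlexanderMap_alexanderMap.map_vadd, translation_displacement, LinearMap.mem_ker.mp m.2,
    zero_smul, sub_zero]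

end Displacement

end LinkDiagram

/-! ### Finitely supported functions and permutations -/

theorem ker_lmapDomain_quotMk {α R : Type*} [Ring R] (r : α → α → Prop) :
    LinearMap.ker (Finsupp.lmapDomain R R (Quot.mk r)) =
      Submodule.span R {x | ∃ a b, r a b ∧ Finsupp.single a 1 - Finsupp.single b 1 = x} := by
  set S := Submodule.span R {x | ∃ a b, r a b ∧ Finsupp.single a (1 : R) - Finsupp.single b 1 = x}
  refine le_antisymm ?_ (Submodule.span_le.mpr ?_)
  · let retract : (Quot r →₀ R) →ₗ[R] (α →₀ R) ⧸ S :=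
      Finsupp.linearCombination R (Quot.lift (fun a => S.mkQ (Finsupp.single a 1)) fun a b hab => by
        rw [← sub_eq_zero, ← map_sub, ← LinearMap.mem_ker, Submodule.ker_mkQ]
        exact Submodule.subset_span ⟨a, b, hab, rfl⟩)
    have retract_comp : retract ∘ₗ Finsupp.lmapDomain R R (Quot.mk r) = S.mkQ := by
      ext a
      simp [retract]
    rw [← S.ker_mkQ, ← retract_comp]
    exact LinearMap.ker_le_ker_comp _ _
  · rintro _ ⟨a, b, hab, rfl⟩
    simp only [SetLike.mem_coe, LinearMap.mem_ker, map_sub, Finsupp.lmapDomain_apply,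
      Finsupp.mapDomain_single, Quot.sound hab, sub_self]

theorem apply_perm_eq_of_sum_smul_single_sub_eq_zero {α R : Type*} [Fintype α] [Ring R]
    {σ : Equiv.Perm α} {ν : α → R}
    (h : ∑ a, ν a • (Finsupp.single (σ.symm a) (1 : R) - Finsupp.single a 1) = 0) (a : α) :
    ν (σ a) = ν a := by
  classical
  have h_apply := DFunLike.congr_fun h a
  simpa [Finsupp.finsetSum_apply, Finsupp.single_apply, mul_sub, Finset.sum_sub_distrib,
    Equiv.symm_apply_eq, sub_eq_zero] using h_apply

section SameCycle

variable {α : Type*} {σ : Equiv.Perm α}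

theorem apply_eq_of_sameCycle [Finite α] {β : Type*} {ν : α → β} (hν : ∀ a, ν (σ a) = ν a) {a b : α}
    (h : σ.SameCycle a b) : ν a = ν b := by
  obtain ⟨n, rfl⟩ := h.exists_nat_pow_eq
  have semiconj : Function.Semiconj ν σ id := hν
  rw [← Equiv.Perm.iterate_eq_pow, (semiconj.iterate_right n).eq, Function.iterate_id, id]

open Classical in
theorem sum_range_minimalPeriod_eq_sum_sameCycle [Fintype α] {M : Type*} [AddCommMonoid M]
    (f : α → M) (a : α) :
    ∑ i ∈ Finset.range (Function.minimalPeriod σ a), f ((σ ^ (i + 1)) a) =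
      ∑ b with σ.SameCycle a b, f b := by
  have period_pos : 0 < Function.minimalPeriod σ a :=
    Function.minimalPeriod_pos_of_mem_periodicPts (σ.injective.mem_periodicPts a)
  refine Finset.sum_nbij (fun i => (σ ^ (i + 1)) a) (fun i _ => ?_) (fun i hi j hj hij => ?_)
    (fun b hb => ?_) fun _ _ => rfl
  · simp [Equiv.Perm.SameCycle.refl]
  · simp only [pow_succ', Equiv.Perm.mul_apply, ← Equiv.Perm.iterate_eq_pow] at hij
    exact Function.iterate_injOn_Iio_minimalPeriod (by simpa using hi) (by simpa using hj)
      (σ.injective hij)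
  · obtain ⟨k, hk⟩ : ∃ k : ℕ, (σ ^ k) a = σ⁻¹ b := by
      simpa using (show σ.SameCycle a (σ⁻¹ b) by simpa using hb).exists_nat_pow_eq
    refine ⟨k % Function.minimalPeriod σ a, by simpa using Nat.mod_lt k period_pos, ?_⟩
    simp only [pow_succ', Equiv.Perm.mul_apply, ← Equiv.Perm.iterate_eq_pow] at hk ⊢
    rw [Function.iterate_mod_minimalPeriod_eq, hk, Equiv.Perm.inv_def, Equiv.apply_symm_apply]

end SameCycle

/-! ### Modules modulo `1 - t` -/

section

variable {M N : Type*} [AddCommGroup M] [AddCommGroup N] [Module ℤ[T;T⁻¹] M] [Module ℤ[T;T⁻¹] N]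

theorem sub_sum_augmentation_zsmul_mem_span {ι : Type*} [Fintype ι]
    (hM : Function.Injective fun m : M => (1 - T 1 : ℤ[T;T⁻¹]) • m) {r e : ι → M}
    {v : ι → ℤ[T;T⁻¹]} {x : M} (hx : (1 - T 1 : ℤ[T;T⁻¹]) • x = ∑ i, v i • r i)
    (hv : ∑ i, augmentation (v i) • (r i - (1 - T 1 : ℤ[T;T⁻¹]) • e i) = 0) :
    x - ∑ i, augmentation (v i) • e i ∈ Submodule.span ℤ[T;T⁻¹] (Set.range r) := by
  choose w hw using fun i => one_sub_T_one_dvd_sub_C_augmentation (v i)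
  have h_eq : x - ∑ i, augmentation (v i) • e i = ∑ i, w i • r i := hM <| by
    dsimp only
    rw [smul_sub, hx, Finset.smul_sum, Finset.smul_sum, ← sub_zero (∑ i, v i • r i - _), ← hv,
      ← Finset.sum_sub_distrib, ← Finset.sum_sub_distrib]
    refine Finset.sum_congr rfl fun i _ => ?_
    rw [smul_smul, ← hw, eq_intCast C, sub_smul (v i), Int.cast_smul_eq_zsmul]
    module
  rw [h_eq]
  exact sum_mem fun i _ => Submodule.smul_mem _ _ (Submodule.subset_span ⟨i, rfl⟩)

/-- The class of `d` freely generates the abelian group `M / (1 - t) M`. -/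
def IsFreeGeneratorModOneSubT (d : M) : Prop :=
  (∀ m, ∃ (k : ℤ) (n : M), m = k • d + (1 - T 1 : ℤ[T;T⁻¹]) • n) ∧
    ∀ (k : ℤ) (n : M), k • d = (1 - T 1 : ℤ[T;T⁻¹]) • n → k = 0

/-- The infinite cyclic groups `M / (1 - t) M` and `N / (1 - t) N` have only two isomorphisms, which
differ by a sign. -/
theorem IsFreeGeneratorModOneSubT.exists_linearEquiv_apply_eq_add {d : M} {d' : N}
    (hd : IsFreeGeneratorModOneSubT d) (hd' : IsFreeGeneratorModOneSubT d')
    (e : M ≃ₗ[ℤ[T;T⁻¹]] N) :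
    ∃ (f : M ≃ₗ[ℤ[T;T⁻¹]] N) (n : N), f d = d' + (1 - T 1 : ℤ[T;T⁻¹]) • n := by
  obtain ⟨k, n, hk⟩ := hd'.1 (e d)
  obtain ⟨l, m, hl⟩ := hd.1 (e.symm d')
  have smul_eq : (1 - l * k) • d' = (1 - T 1 : ℤ[T;T⁻¹]) • (l • n + e m) := by
    have h := congrArg e hl
    rw [e.apply_symm_apply, map_add, map_zsmul, map_smul, hk] at h
    linear_combination (norm := module) h
  have mul_eq_one : l * k = 1 := (sub_eq_zero.mp (hd'.2 _ _ smul_eq)).symm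
  rcases Int.isUnit_iff.mp (IsUnit.of_mul_eq_one_right l mul_eq_one) with rfl | rfl
  · exact ⟨e, n, by rw [hk, one_smul]⟩
  · refine ⟨e.trans (LinearEquiv.neg _), -n, ?_⟩
    rw [LinearEquiv.trans_apply, hk, LinearEquiv.neg_apply]
    module

theorem image_setOf_eq_or_eq_add {d : M} {d' n : N} {f : M ≃ₗ[ℤ[T;T⁻¹]] N}
    (hf : f d = d' + (1 - T 1 : ℤ[T;T⁻¹]) • n) :
    f '' {x | ∃ m : M, x = (1 - T 1 : ℤ[T;T⁻¹]) • m ∨ x = d + (1 - T 1 : ℤ[T;T⁻¹]) • m} =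
      {y | ∃ m : N, y = (1 - T 1 : ℤ[T;T⁻¹]) • m ∨ y = d' + (1 - T 1 : ℤ[T;T⁻¹]) • m} := by
  ext y
  constructor
  · rintro ⟨_, ⟨m, rfl | rfl⟩, rfl⟩
    · exact ⟨f m, .inl (map_smul _ _ _)⟩
    · exact ⟨n + f m, .inr (by rw [map_add, map_smul, hf]; module)⟩
  · rintro ⟨m, rfl | rfl⟩
    · exact ⟨_, ⟨f.symm m, .inl rfl⟩, by rw [map_smul, f.apply_symm_apply]⟩
    · refine ⟨_, ⟨f.symm (m - n), .inr rfl⟩, ?_⟩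
      rw [map_add, map_smul, f.apply_symm_apply, hf]
      module

end

instance : CharZero (ℤ[T;T⁻¹] ⧸ Ideal.span {(1 - T 1 : ℤ[T;T⁻¹])}) :=
  charZero_of_inj_zero fun k hk => by
    rw [← map_natCast (Ideal.Quotient.mk _), Ideal.Quotient.eq_zero_iff_mem,
      Ideal.mem_span_singleton] at hk
    simpa using map_dvd augmentation hk

theorem one_sub_T_one_smul_quotient (x : ℤ[T;T⁻¹] ⧸ Ideal.span {(1 - T 1 : ℤ[T;T⁻¹])}) :
    (1 - T 1 : ℤ[T;T⁻¹]) • x = 0 := by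
  obtain ⟨p, rfl⟩ := Ideal.Quotient.mk_surjective x
  exact Ideal.Quotient.eq_zero_iff_mem.mpr
    (Ideal.mul_mem_right _ _ (Ideal.mem_span_singleton_self _))

/-! ### Alexander numberings of classical diagrams -/

namespace Passage

variable {C : Type}

/-- The crossing of a passage. -/
def crossing : Passage C → C
  | .over c => c
  | .under c => c

/-- Passages are crossings with a choice of the upper or the lower strand. -/
def equivSum (C : Type) : C ⊕ C ≃ Passage C where
  toFun := Sum.elim .over .under
  invFun
    | .over c => .inl c
    | .under c => .inr c
  left_inv := by rintro (c | c) <;> rfl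
  right_inv := by rintro (c | c) <;> rfl

instance [Fintype C] : Fintype (Passage C) := .ofEquiv _ (equivSum C)

theorem sum_eq {M : Type*} [Fintype C] [AddCommMonoid M] (f : Passage C → M) :
    ∑ p, f p = ∑ c, (f (.over c) + f (.under c)) := by
  rw [← (equivSum C).sum_comp, Fintype.sum_sum_type, Finset.sum_add_distrib]
  rfl

end Passage

/-- The crossing of a half-edge. -/
def HalfEdge.crossing {C : Type} : HalfEdge C → C
  | .enter p => p.crossing
  | .leave p => p.crossing

instance {C : Type} [Finite C] : Finite (HalfEdge C) :=
  have := Fintype.ofFinite C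
  Finite.of_surjective (Sum.elim HalfEdge.enter HalfEdge.leave) fun
    | .enter p => ⟨.inl p, rfl⟩
    | .leave p => ⟨.inr p, rfl⟩

namespace LinkDiagram

section Faces

variable {D : LinkDiagram}

instance : Finite D.Face := inferInstanceAs (Finite (Quotient _))

instance : Finite D.Piece := inferInstanceAs (Finite (Quotient _))

noncomputable instance : Fintype D.Face := Fintype.ofFinite _

noncomputable instance : Fintype D.Piece := Fintype.ofFinite _

/-- The face on the right of a half-edge, directed towards the other half. -/
def faceOf (x : HalfEdge D.Crossing) : D.Face := Quotient.mk _ x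

/-- The connected piece of a half-edge. -/
def pieceOf (x : HalfEdge D.Crossing) : D.Piece := Quotient.mk _ x

theorem faceOf_edgeFlip (x : HalfEdge D.Crossing) :
    faceOf (D.edgeFlip x) = faceOf (D.rotation x) := by
  refine Quotient.sound ⟨1, ?_⟩
  rw [zpow_one, Equiv.Perm.mul_apply]
  exact congrArg D.rotation (D.edgeFlip.left_inv x)

theorem crossing_rotation (x : HalfEdge D.Crossing) : (D.rotation x).crossing = x.crossing := by
  rcases x with (c | c) | (c | c) <;> cases hc : D.positive c <;>
    simp [rotation, ccw, hc, HalfEdge.crossing, Passage.crossing]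

theorem exists_eq_comp_pieceOf {Y : Type*} (f : HalfEdge D.Crossing → Y)
    (hrot : ∀ x, f (D.rotation x) = f x) (hflip : ∀ x, f (D.edgeFlip x) = f x) :
    ∃ g : D.Piece → Y, ∀ x, f x = g (pieceOf x) := by
  have map_smul_eq (g : Equiv.Perm (HalfEdge D.Crossing))
      (hg : g ∈ Subgroup.closure {D.rotation, D.edgeFlip}) : ∀ x, f (g x) = f x := by
    induction hg using Subgroup.closure_induction with
    | mem g hg =>
      rcases hg with rfl | rfl
      · exact hrot
      · exact hflip
    | one => exact fun _ => rfl
    | mul g g' _ _ hg hg' => exact fun x => (hg _).trans (hg' x)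
    | inv g _ hg => exact fun x => (hg _).symm.trans (congrArg f (g.apply_symm_apply x))
  refine ⟨Quotient.lift f ?_, fun x => rfl⟩
  rintro _ x ⟨⟨g, hg⟩, rfl⟩
  exact map_smul_eq g hg x

section CommRing

variable {R : Type*} [CommRing R]

variable (D R) in
/-- The differences of a function on the faces across the edges, where the edge that leaves a
passage stands for the passage. -/
def edgeDifference : (D.Face → R) →ₗ[R] (Passage D.Crossing → R) :=
  LinearMap.funLeft R R (fun p => faceOf (.leave p)) -
    LinearMap.funLeft R R fun p => faceOf (.enter (D.next p))

variable (D R) in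
/-- The excess of the outgoing over the incoming edges at a crossing. -/
def crossingExcess : (Passage D.Crossing → R) →ₗ[R] (D.Crossing → R) :=
  (LinearMap.funLeft R R .over - LinearMap.funLeft R R fun c => D.next.symm (.over c)) +
    (LinearMap.funLeft R R .under - LinearMap.funLeft R R fun c => D.next.symm (.under c))

theorem edgeDifference_apply (h : D.Face → R) (p : Passage D.Crossing) :
    D.edgeDifference R h p = h (faceOf (.leave p)) - h (faceOf (.enter (D.next p))) := rfl

theorem crossingExcess_apply (g : Passage D.Crossing → R) (c : D.Crossing) :
    D.crossingExcess R g c = (g (.over c) - g (D.next.symm (.over c))) +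
      (g (.under c) - g (D.next.symm (.under c))) := rfl

theorem edgeDifference_eq_sub_rotation_leave (h : D.Face → R) (p : Passage D.Crossing) :
    D.edgeDifference R h p = h (faceOf (.leave p)) - h (faceOf (D.rotation (.leave p))) := by
  rw [← faceOf_edgeFlip]
  rfl

theorem edgeDifference_next_symm (h : D.Face → R) (p : Passage D.Crossing) :
    D.edgeDifference R h (D.next.symm p) =
      h (faceOf (D.rotation (.enter p))) - h (faceOf (.enter p)) := by
  rw [← faceOf_edgeFlip, edgeDifference_apply, Equiv.apply_symm_apply]
  rfl

theorem crossingExcess_edgeDifference (h : D.Face → R) :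
    D.crossingExcess R (D.edgeDifference R h) = 0 := by
  ext c
  rw [crossingExcess_apply, edgeDifference_next_symm, edgeDifference_next_symm,
    edgeDifference_eq_sub_rotation_leave, edgeDifference_eq_sub_rotation_leave]
  cases hc : D.positive c <;> simp [rotation, ccw, hc] <;> ring

theorem sum_mul_crossingExcess (y : D.Crossing → R) (g : Passage D.Crossing → R) :
    ∑ c, y c * D.crossingExcess R g c =
      ∑ p, (y p.crossing - y (D.next p).crossing) * g p := by
  have sum_next : ∑ p, y (D.next p).crossing * g p = ∑ p, y p.crossing * g (D.next.symm p) := by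
    rw [← Equiv.sum_comp D.next fun p => y p.crossing * g (D.next.symm p)]
    simp only [Equiv.symm_apply_apply]
  simp only [sub_mul, Finset.sum_sub_distrib]
  rw [sum_next, ← Finset.sum_sub_distrib, Passage.sum_eq]
  refine Finset.sum_congr rfl fun c _ => ?_
  rw [crossingExcess_apply, Passage.crossing, Passage.crossing]
  ring

theorem exists_eq_comp_pieceOf_of_edgeDifference_eq_zero {h : D.Face → R}
    (hh : D.edgeDifference R h = 0) : ∃ g : D.Piece → R, ∀ x, h (faceOf x) = g (pieceOf x) := by
  have hflip (x : HalfEdge D.Crossing) : h (faceOf (D.edgeFlip x)) = h (faceOf x) := by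
    match x with
    | .leave p => exact (sub_eq_zero.mp (congrFun hh p)).symm
    | .enter p =>
      have hp := congrFun hh (D.next.symm p)
      rw [edgeDifference_next_symm, ← faceOf_edgeFlip] at hp
      exact sub_eq_zero.mp hp
  exact exists_eq_comp_pieceOf (fun x => h (faceOf x))
    (fun x => by rw [← faceOf_edgeFlip, hflip]) hflip

theorem exists_eq_comp_pieceOf_of_sum_mul_crossingExcess_eq_zero {y : D.Crossing → R}
    (hy : ∀ g, ∑ c, y c * D.crossingExcess R g c = 0) :
    ∃ g : D.Piece → R, ∀ x : HalfEdge D.Crossing, y x.crossing = g (pieceOf x) := by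
  classical
  have crossing_next (p) : y p.crossing = y (D.next p).crossing := by
    have h := hy (Pi.single p 1)
    rw [sum_mul_crossingExcess] at h
    simpa [Pi.single_apply, sub_eq_zero] using h
  refine exists_eq_comp_pieceOf (fun x => y x.crossing)
    (fun x => congrArg y (crossing_rotation x)) fun x => ?_
  match x with
  | .leave p => exact (crossing_next p).symm
  | .enter p => exact (crossing_next _).trans (by rw [Equiv.apply_symm_apply]; rfl)

end CommRing

section Field

variable (D) (K : Type*) [Field K]

theorem finrank_ker_edgeDifference_le :
    Module.finrank K (LinearMap.ker (D.edgeDifference K)) ≤ Nat.card D.Piece := by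
  let pullback : (D.Piece → K) →ₗ[K] (D.Face → K) :=
    LinearMap.funLeft K K fun x => pieceOf x.out
  have ker_le : LinearMap.ker (D.edgeDifference K) ≤ LinearMap.range pullback := fun h hh => by
    obtain ⟨g, hg⟩ := exists_eq_comp_pieceOf_of_edgeDifference_eq_zero hh
    exact ⟨g, funext fun x => (hg _).symm.trans (congrArg h (Quotient.out_eq x))⟩
  refine (Submodule.finrank_mono ker_le).trans ((LinearMap.finrank_range_le _).trans ?_)
  rw [Module.finrank_pi, Nat.card_eq_fintype_card]

theorem card_crossing_le_finrank_range_crossingExcess_add :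
    Nat.card D.Crossing ≤
      Module.finrank K (LinearMap.range (D.crossingExcess K)) + Nat.card D.Piece := by
  classical
  let pullback : (D.Piece → K) →ₗ[K] Module.Dual K (D.Crossing → K) :=
    (dotProductEquiv K D.Crossing).toLinearMap ∘ₗ
      LinearMap.funLeft K K fun c => pieceOf (.leave (.over c))
  have ker_le : LinearMap.ker (D.crossingExcess K).dualMap ≤ LinearMap.range pullback := by
    intro l hl
    obtain ⟨y, rfl⟩ := (dotProductEquiv K D.Crossing).surjective l
    obtain ⟨g, hg⟩ :=
      exists_eq_comp_pieceOf_of_sum_mul_crossingExcess_eq_zero (LinearMap.congr_fun hl)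
    exact ⟨g, congrArg (dotProductEquiv K D.Crossing) (funext fun c => (hg _).symm)⟩
  have rank_nullity := LinearMap.finrank_range_add_finrank_ker (D.crossingExcess K).dualMap
  rw [LinearMap.finrank_range_dualMap_eq_finrank_range, Subspace.dual_finrank_eq,
    Module.finrank_pi, ← Nat.card_eq_fintype_card] at rank_nullity
  have finrank_ker_le := (Submodule.finrank_mono ker_le).trans (LinearMap.finrank_range_le _)
  rw [Module.finrank_pi, ← Nat.card_eq_fintype_card] at finrank_ker_le
  omega

variable {D}

/-- Together with the bounds on the two ranks, Euler's formula forces exactness at the edges. -/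
theorem IsClassical.range_edgeDifference (hD : D.IsClassical) :
    LinearMap.range (D.edgeDifference K) = LinearMap.ker (D.crossingExcess K) := by
  refine Submodule.eq_of_le_of_finrank_le ?_ ?_
  · rintro _ ⟨h, rfl⟩
    exact crossingExcess_edgeDifference h
  · have rank_nullity := LinearMap.finrank_range_add_finrank_ker (D.edgeDifference K)
    have rank_nullity' := LinearMap.finrank_range_add_finrank_ker (D.crossingExcess K)
    rw [Module.finrank_pi, ← Nat.card_eq_fintype_card] at rank_nullity rank_nullity'
    have finrank_ker_le := D.finrank_ker_edgeDifference_le K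
    have card_crossing_le := D.card_crossing_le_finrank_range_crossingExcess_add K
    unfold IsClassical at hD
    omega

end Field

theorem IsClassical.exists_edgeDifference_eq_one (hD : D.IsClassical) :
    ∃ h : D.Face → ℤ, D.edgeDifference ℤ h = 1 := by
  have one_mem : (1 : Passage D.Crossing → ℚ) ∈ LinearMap.ker (D.crossingExcess ℚ) := by
    ext c
    simp [crossingExcess_apply]
  rw [← hD.range_edgeDifference ℚ] at one_mem
  obtain ⟨h, hh⟩ := one_mem
  refine ⟨fun x => ⌊h x⌋, funext fun p => ?_⟩
  have h_eq : h (faceOf (.leave p)) = h (faceOf (.enter (D.next p))) + 1 :=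
    sub_eq_iff_eq_add'.mp (congrFun hh p)
  simp only [edgeDifference_apply, h_eq, Int.floor_add_one, add_sub_cancel_left, Pi.one_apply]

variable (D) in
/-- Alexander numberings: numberings of the edges that come from a numbering of the faces which
increases by one across every edge from the left to the right. An edge has the number of the face
on its right. -/
def IsAlexanderNumbering (κ : Passage D.Crossing → ℤ) : Prop :=
  ∀ c, if D.positive c then
      κ (.over c) = κ (.under c) + 1 ∧ κ (D.next.symm (.over c)) = κ (.under c) ∧
        κ (D.next.symm (.under c)) = κ (.under c) + 1
    else
      κ (.under c) = κ (.over c) + 1 ∧ κ (D.next.symm (.over c)) = κ (.over c) + 1 ∧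
        κ (D.next.symm (.under c)) = κ (.over c)

theorem isAlexanderNumbering_of_edgeDifference_eq_one {h : D.Face → ℤ}
    (hh : D.edgeDifference ℤ h = 1) : D.IsAlexanderNumbering fun p => h (faceOf (.leave p)) := by
  intro c
  have leave_eq (p) := (edgeDifference_eq_sub_rotation_leave h p).symm.trans (congrFun hh p)
  have enter_eq (p) := (edgeDifference_next_symm h p).symm.trans (congrFun hh (D.next.symm p))
  have prev_eq (p) :=
    (edgeDifference_eq_sub_rotation_leave h (D.next.symm p)).symm.trans (congrFun hh _)
  have prev_rotation (p) : faceOf (D.rotation (.leave (D.next.symm p))) = faceOf (.enter p) := by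
    rw [← faceOf_edgeFlip]
    exact congrArg (fun q => faceOf (.enter q)) (D.next.apply_symm_apply p)
  have h₁ := leave_eq (.over c)
  have h₂ := leave_eq (.under c)
  have h₃ := enter_eq (.over c)
  have h₄ := enter_eq (.under c)
  have h₅ := prev_eq (.over c)
  have h₆ := prev_eq (.under c)
  rw [prev_rotation] at h₅ h₆
  cases hc : D.positive c
  · simp only [rotation, ccw, hc, Equiv.coe_fn_mk, Bool.false_eq_true, if_false,
      Pi.one_apply] at *
    omega
  · simp only [rotation, ccw, hc, Equiv.coe_fn_mk, if_true, Pi.one_apply] at *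
    omega

variable (D) in
/-- The diagram has an Alexander numbering. Links with such a virtual diagram are called almost
classical. -/
def IsAlmostClassical : Prop := ∃ κ, D.IsAlexanderNumbering κ

theorem IsClassical.isAlmostClassical (hD : D.IsClassical) : D.IsAlmostClassical :=
  let ⟨_, h⟩ := hD.exists_edgeDifference_eq_one
  ⟨_, isAlexanderNumbering_of_edgeDifference_eq_one h⟩

end Faces

end LinkDiagram

/-! ### Longitudes -/

namespace LinkDiagram

section Relators

variable {D : LinkDiagram}

/-- The sign of a crossing. -/
def crossingSign (c : D.Crossing) : ℤ := if D.positive c then 1 else -1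

theorem crossingSign_mul_self (c : D.Crossing) : crossingSign c * crossingSign c = 1 := by
  unfold crossingSign
  split <;> rfl

theorem arcAfter_next_symm_over (c : D.Crossing) :
    D.arcAfter (D.next.symm (.over c)) = D.overArc c :=
  congrArg Sum.inl (Quot.sound (.mk _ c (D.next.apply_symm_apply _)))

theorem relator_sub_one_sub_T_one_smul (c : D.Crossing) :
    D.relator c - (1 - T 1 : ℤ[T;T⁻¹]) •
        (Finsupp.single (D.overArc c) 1 - Finsupp.single (D.rightArc c) 1) =
      Finsupp.single (D.rightArc c) 1 - Finsupp.single (D.leftArc c) 1 := by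
  simp only [relator, smul_sub, Finsupp.smul_single, smul_eq_mul, mul_one, Finsupp.single_sub]
  abel

theorem single_rightArc_sub_leftArc {R : Type*} [Ring R] (c : D.Crossing) :
    Finsupp.single (D.rightArc c) (1 : R) - Finsupp.single (D.leftArc c) 1 =
      crossingSign c • (Finsupp.single (D.underIn c) 1 - Finsupp.single (D.underOut c) 1) := by
  unfold rightArc leftArc crossingSign
  split <;> simp

theorem range_reducedRho :
    LinearMap.range D.reducedRho = Submodule.span ℤ[T;T⁻¹] (Set.range D.relator) :=
  Finsupp.range_linearCombination _

theorem sum_map_smul_single_rightArc_sub_leftArc {S : Type*} [Ring S] (f : ℤ[T;T⁻¹] →+* S)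
    (hf : f (T 1) = 1) {x : D.Arc →₀ ℤ[T;T⁻¹]} {v : D.Crossing → ℤ[T;T⁻¹]}
    (hx : (1 - T 1 : ℤ[T;T⁻¹]) • x = ∑ c, v c • D.relator c) :
    ∑ c, f (v c) • (Finsupp.single (D.rightArc c) (1 : S) - Finsupp.single (D.leftArc c) 1) =
      0 := by
  let F := Finsupp.mapRange.addMonoidHom (ι := D.Arc) f.toAddMonoidHom
  have F_smul (p : ℤ[T;T⁻¹]) (y) : F (p • y) = f p • F y := by
    ext a
    simp [F]
  have F_relator (c) : F (D.relator c) =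
      Finsupp.single (D.rightArc c) 1 - Finsupp.single (D.leftArc c) 1 := by
    have F_single (a p) : F (Finsupp.single a p) = Finsupp.single a (f p) :=
      Finsupp.mapRange_single (hf := map_zero f)
    simp only [relator, map_add, map_sub, F_single, map_one, hf, sub_self, Finsupp.single_zero,
      zero_add]
  have h := congrArg F hx
  rw [F_smul, map_sub, map_one, hf, sub_self, zero_smul, map_sum] at h
  simpa only [F_smul, F_relator] using h.symm

/-- Relations modulo `1 - t` between the relators produce elements killed by `1 - t`. -/
theorem mkQ_eq_sum_augmentation_zsmul {x : D.Arc →₀ ℤ[T;T⁻¹]} {v : D.Crossing → ℤ[T;T⁻¹]}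
    (hx : (1 - T 1 : ℤ[T;T⁻¹]) • x = ∑ c, v c • D.relator c) :
    (LinearMap.range D.reducedRho).mkQ x =
      ∑ c, augmentation (v c) • (arcClass (D.overArc c) - arcClass (D.rightArc c)) := by
  have h_mem := sub_sum_augmentation_zsmul_mem_span (smul_right_injective _ one_sub_T_one_ne_zero)
    (e := fun c => Finsupp.single (D.overArc c) 1 - Finsupp.single (D.rightArc c) 1) hx (by
      simpa only [relator_sub_one_sub_T_one_smul, RingHom.comp_apply, eq_intCast,
        Int.cast_smul_eq_zsmul] using sum_map_smul_single_rightArc_sub_leftArc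
          ((Int.castRingHom ℤ[T;T⁻¹]).comp augmentation) (by simp) hx)
  rw [← range_reducedRho, ← Submodule.ker_mkQ (LinearMap.range D.reducedRho), LinearMap.mem_ker,
    map_sub, sub_eq_zero] at h_mem
  rw [h_mem]
  simp only [map_sum, map_zsmul, map_sub, arcClass]

theorem IsAlexanderNumbering.smul_relator {κ : Passage D.Crossing → ℤ}
    (hκ : D.IsAlexanderNumbering κ) (c : D.Crossing) :
    ((crossingSign c : ℤ[T;T⁻¹]) * T (if D.positive c then κ (.under c) else κ (.over c))) •
        D.relator c =
      (Finsupp.single (D.overArc c) (T (κ (D.next.symm (.over c)))) -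
          Finsupp.single (D.overArc c) (T (κ (.over c)))) +
        (Finsupp.single (D.underIn c) (T (κ (D.next.symm (.under c)))) -
          Finsupp.single (D.underOut c) (T (κ (.under c)))) := by
  have h := hκ c
  have single_eq (a : D.Arc) (p : ℤ[T;T⁻¹]) : Finsupp.single a p = p • Finsupp.single a 1 := by
    simp
  unfold relator rightArc leftArc crossingSign
  cases hc : D.positive c
  · simp only [hc, Bool.false_eq_true, if_false] at h ⊢
    obtain ⟨h_under, h_over_in, h_under_in⟩ := h
    rw [h_under, h_over_in, h_under_in]
    simp only [single_eq _ (T _), single_eq _ (T _ * T _), single_eq _ (1 - T _), T_add,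
      Int.cast_neg, Int.cast_one]
    module
  · simp only [hc, if_true] at h ⊢
    obtain ⟨h_over, h_over_in, h_under_in⟩ := h
    rw [h_over, h_over_in, h_under_in]
    simp only [single_eq _ (T _), single_eq _ (T _ * T _), single_eq _ (1 - T _), T_add,
      Int.cast_one]
    module

theorem IsAlexanderNumbering.sum_smul_relator {κ : Passage D.Crossing → ℤ}
    (hκ : D.IsAlexanderNumbering κ) :
    ∑ c, ((crossingSign c : ℤ[T;T⁻¹]) *
      T (if D.positive c then κ (.under c) else κ (.over c))) • D.relator c = 0 := by
  let f (p : Passage D.Crossing) : D.Arc →₀ ℤ[T;T⁻¹] := Finsupp.single (D.arcAfter p) (T (κ p))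
  calc
    _ = ∑ p, (f (D.next.symm p) - f p) := by
      rw [Passage.sum_eq]
      refine Finset.sum_congr rfl fun c _ => ?_
      rw [hκ.smul_relator]
      simp only [f, arcAfter_next_symm_over]
      rfl
    _ = 0 := by rw [Finset.sum_sub_distrib, Equiv.sum_comp D.next.symm f, sub_self]

end Relators

section Components

variable {D : LinkDiagram}

noncomputable instance : Fintype D.Component :=
  have : Finite (Quotient (Equiv.Perm.SameCycle.setoid D.next)) := inferInstance
  Fintype.ofFinite (Quotient (Equiv.Perm.SameCycle.setoid D.next) ⊕ Fin D.numFreeCircles)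

/-- The component of a passage. -/
def passageComponent (p : Passage D.Crossing) : D.Component := .inl (Quotient.mk _ p)

theorem passageComponent_eq_iff {p q : Passage D.Crossing} :
    passageComponent p = passageComponent q ↔ D.next.SameCycle p q :=
  Sum.inl_injective.eq_iff.trans Quotient.eq

theorem passageComponent_next (p : Passage D.Crossing) :
    passageComponent (D.next p) = passageComponent p :=
  passageComponent_eq_iff.mpr (by simp [Equiv.Perm.SameCycle.refl])

/-- The component of an arc. -/
def arcComponent : D.Arc → D.Component :=
  Sum.map (Quot.lift (Quotient.mk _) (by
    rintro _ _ ⟨c, h⟩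
    exact Quotient.sound ⟨1, by rw [zpow_one, h]⟩)) id

theorem arcComponent_arcAfter (p : Passage D.Crossing) :
    arcComponent (D.arcAfter p) = passageComponent p := rfl

theorem arcComponent_surjective : Function.Surjective (arcComponent (D := D)) := by
  rintro (⟨⟨p⟩⟩ | j)
  · exact ⟨D.arcAfter p, rfl⟩
  · exact ⟨.inr j, rfl⟩

theorem arcComponent_leftArc (c : D.Crossing) :
    arcComponent (D.leftArc c) = arcComponent (D.rightArc c) := by
  have h : arcComponent (D.underIn c) = arcComponent (D.underOut c) := by
    rw [underIn, underOut, arcComponent_arcAfter, arcComponent_arcAfter, ← passageComponent_next,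
      Equiv.apply_symm_apply]
  unfold leftArc rightArc
  split
  · exact h.symm
  · exact h

variable (D) in
/-- The class of an element of the reduced Alexander module modulo `1 - t`, which only remembers the
components of the arcs. -/
noncomputable def componentClass : D.ReducedAlexanderModule →ₗ[ℤ[T;T⁻¹]]
    (D.Component →₀ ℤ[T;T⁻¹] ⧸ Ideal.span {(1 - T 1 : ℤ[T;T⁻¹])}) :=
  lift (fun a => Finsupp.single (arcComponent a) 1) fun c => by
    have one_sub_T_one_smul (i : D.Component) : (1 - T 1 : ℤ[T;T⁻¹]) •
        Finsupp.single i (1 : ℤ[T;T⁻¹] ⧸ Ideal.span {(1 - T 1 : ℤ[T;T⁻¹])}) = 0 := by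
      rw [Finsupp.smul_single, one_sub_T_one_smul_quotient, Finsupp.single_zero]
    have T_one_smul := one_sub_T_one_smul (arcComponent (D.rightArc c))
    rw [sub_smul, one_smul, sub_eq_zero] at T_one_smul
    rw [one_sub_T_one_smul, zero_add, ← T_one_smul, arcComponent_leftArc]

@[simp]
theorem componentClass_arcClass (a : D.Arc) :
    D.componentClass (arcClass a) = Finsupp.single (arcComponent a) 1 :=
  lift_arcClass _ _ _

theorem componentClass_one_sub_T_one_smul (m : D.ReducedAlexanderModule) :
    D.componentClass ((1 - T 1 : ℤ[T;T⁻¹]) • m) = 0 := by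
  rw [map_smul]
  ext1 i
  exact one_sub_T_one_smul_quotient _

theorem componentClass_alexanderMap_displacement_vadd (o : D.MedialQuandle)
    (m : D.ReducedAlexanderInvariant) (a : D.Arc) :
    D.componentClass
        (D.alexanderMap (displacement o (m : D.ReducedAlexanderModule) +ᵥ arcElement a)) =
      Finsupp.single (arcComponent a) 1 := by
  rw [alexanderMap_displacement_vadd, map_add, componentClass_one_sub_T_one_smul, add_zero,
    alexanderMap_arcElement, componentClass_arcClass]

end Components

section Longitude

variable {D : LinkDiagram}

theorem ker_lmapDomain_arcAfter (R : Type*) [Ring R] :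
    LinearMap.ker (Finsupp.lmapDomain R R D.arcAfter) = Submodule.span R (Set.range fun c =>
      Finsupp.single (D.next.symm (.over c)) 1 - Finsupp.single (.over c) 1) := by
  have ker_eq : LinearMap.ker (Finsupp.lmapDomain R R D.arcAfter) =
      LinearMap.ker (Finsupp.lmapDomain R R (Quot.mk D.Continues)) := by
    change LinearMap.ker (Finsupp.lmapDomain R R (Sum.inl ∘ Quot.mk D.Continues)) = _
    rw [Finsupp.lmapDomain_comp]
    exact LinearMap.ker_comp_of_ker_eq_bot _
      (LinearMap.ker_eq_bot.mpr (Finsupp.mapDomain_injective Sum.inl_injective))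
  rw [ker_eq, ker_lmapDomain_quotMk]
  congr 1
  ext x
  constructor
  · rintro ⟨p, _, ⟨c, hc⟩, rfl⟩
    exact ⟨c, by simp only [← hc, Equiv.symm_apply_apply]⟩
  · rintro ⟨c, rfl⟩
    exact ⟨_, _, .mk _ c (D.next.apply_symm_apply _), rfl⟩

theorem exists_apply_passageComponent_under_eq {R : Type*} [Ring R] {n : D.Crossing → R}
    (h : ∑ c, n c • (Finsupp.single (D.underIn c) (1 : R) - Finsupp.single (D.underOut c) 1) = 0) :
    ∃ k : D.Component → R, ∀ c, k (passageComponent (.under c)) = n c := by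
  have h_mem : ∑ c, n c • (Finsupp.single (D.next.symm (.under c)) (1 : R) -
      Finsupp.single (.under c) 1) ∈ LinearMap.ker (Finsupp.lmapDomain R R D.arcAfter) := by
    rw [LinearMap.mem_ker]
    simp only [map_sum, map_smul, map_sub]
    simp only [Finsupp.lmapDomain_apply, Finsupp.mapDomain_single]
    exact h
  rw [ker_lmapDomain_arcAfter, Submodule.mem_span_range_iff_exists_fun] at h_mem
  obtain ⟨w, hw⟩ := h_mem
  let ν : Passage D.Crossing → R
    | .over c => -w c
    | .under c => n c
  have ν_next (p) : ν (D.next p) = ν p := apply_perm_eq_of_sum_smul_single_sub_eq_zero (by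
    rw [Passage.sum_eq, Finset.sum_add_distrib, ← hw, ← Finset.sum_add_distrib]
    simp [ν]) p
  exact ⟨Sum.elim (Quotient.lift ν fun _ _ => apply_eq_of_sameCycle ν_next) 0, fun _ => rfl⟩

/-- The reading of a longitude at a passage: the displacement that takes the arc before the passage
to the arc after it. -/
noncomputable def passageShift : Passage D.Crossing → D.ReducedAlexanderInvariant
  | .over _ => 0
  | .under c =>
    crossingSign c • alexanderSub (arcElement (D.overArc c)) (arcElement (D.rightArc c))

open Classical in
/-- The longitude of a component, as an element of the reduced Alexander invariant. -/
noncomputable def longitude (i : D.Component) : D.ReducedAlexanderInvariant :=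
  ∑ p with passageComponent p = i, passageShift p

open Classical in
theorem longitude_passageComponent (p : Passage D.Crossing) :
    longitude (passageComponent p) = ∑ q with D.next.SameCycle p q, passageShift q :=
  Finset.sum_congr (Finset.filter_congr fun _ _ => eq_comm.trans passageComponent_eq_iff)
    fun _ _ => rfl

theorem sum_zsmul_longitude (k : D.Component → ℤ) :
    ∑ i, k i • longitude i = ∑ c, (k (passageComponent (.under c)) * crossingSign c) •
      alexanderSub (arcElement (D.overArc c)) (arcElement (D.rightArc c)) := by
  classical
  calc
    _ = ∑ i, ∑ p with passageComponent p = i, k (passageComponent p) • passageShift p :=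
      Finset.sum_congr rfl fun i _ => by
        rw [longitude, Finset.smul_sum]
        exact Finset.sum_congr rfl fun p hp => by rw [(Finset.mem_filter.mp hp).2]
    _ = ∑ p, k (passageComponent p) • passageShift p := Finset.sum_fiberwise _ _ _
    _ = _ := by simp only [Passage.sum_eq, passageShift, smul_zero, zero_add, mul_smul]

theorem exists_eq_sum_zsmul_longitude {s : D.ReducedAlexanderModule}
    (hs : (1 - T 1 : ℤ[T;T⁻¹]) • s = 0) :
    ∃ k : D.Component → ℤ, s = (∑ i, k i • longitude i : D.ReducedAlexanderInvariant) := by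
  obtain ⟨x, rfl⟩ := Submodule.mkQ_surjective _ s
  rw [← map_smul, Submodule.mkQ_apply, Submodule.Quotient.mk_eq_zero, range_reducedRho,
    Submodule.mem_span_range_iff_exists_fun] at hs
  obtain ⟨v, hv⟩ := hs
  obtain ⟨k, hk⟩ := exists_apply_passageComponent_under_eq (n := fun c =>
      augmentation (v c) * crossingSign c) (by
    simpa only [single_rightArc_sub_leftArc, smul_smul, smul_eq_mul] using
      sum_map_smul_single_rightArc_sub_leftArc augmentation (augmentation_T 1) hv.symm)
  refine ⟨k, ?_⟩
  rw [sum_zsmul_longitude, mkQ_eq_sum_augmentation_zsmul hv.symm]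
  simp [hk, mul_assoc, crossingSign_mul_self]

theorem IsAlmostClassical.sum_longitude (hD : D.IsAlmostClassical) :
    ∑ i : D.Component, longitude i = 0 := by
  obtain ⟨κ, hκ⟩ := hD
  have h := mkQ_eq_sum_augmentation_zsmul (x := 0) ((smul_zero _).trans hκ.sum_smul_relator.symm)
  have h_sum := sum_zsmul_longitude (D := D) 1
  simp only [Pi.one_apply, one_smul, one_mul] at h_sum
  rw [h_sum]
  ext1
  simpa using h.symm

theorem overArc_act_rightArc (c : D.Crossing) :
    arcElement (D.overArc c) ◃ arcElement (D.rightArc c) = arcElement (D.leftArc c) :=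
  PresentedMedialQuandle.of_act_of (.mk c)

variable (o : D.MedialQuandle)

theorem displacement_passageShift_vadd (p : Passage D.Crossing) :
    displacement o (passageShift p : D.ReducedAlexanderModule) +ᵥ
      arcElement (D.arcAfter (D.next.symm p)) = arcElement (D.arcAfter p) := by
  match p with
  | .over c =>
    rw [passageShift, Submodule.coe_zero, map_zero, zero_vadd, arcAfter_next_symm_over, overArc]
  | .under c =>
    change _ +ᵥ arcElement (D.underIn c) = arcElement (D.underOut c)
    have h := overArc_act_rightArc c
    rw [act_eq_displacement_vadd o] at h
    unfold passageShift crossingSign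
    cases hc : D.positive c
    · simp only [leftArc, rightArc, hc, Bool.false_eq_true, if_false] at h ⊢
      rw [← h, neg_one_smul, Submodule.coe_neg, map_neg, neg_vadd_vadd]
    · simpa [leftArc, rightArc, hc] using h

theorem displacement_sum_passageShift_vadd (p : Passage D.Crossing) (n : ℕ) :
    displacement o ((∑ i ∈ Finset.range n, passageShift ((D.next ^ (i + 1)) p) :
      D.ReducedAlexanderInvariant) : D.ReducedAlexanderModule) +ᵥ arcElement (D.arcAfter p) =
      arcElement (D.arcAfter ((D.next ^ n) p)) := by
  induction n with
  | zero => simp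
  | succ n ih =>
    rw [Finset.sum_range_succ, add_comm, Submodule.coe_add, map_add, add_vadd, ih,
      ← displacement_passageShift_vadd o ((D.next ^ (n + 1)) p), pow_succ', Equiv.Perm.mul_apply,
      Equiv.symm_apply_apply]

theorem displacement_longitude_vadd (a : D.Arc) :
    displacement o (longitude (arcComponent a) : D.ReducedAlexanderModule) +ᵥ arcElement a =
      arcElement a := by
  rcases a with ⟨⟨p⟩⟩ | j
  · have h := displacement_sum_passageShift_vadd o p (Function.minimalPeriod D.next p)
    rwa [sum_range_minimalPeriod_eq_sum_sameCycle, ← longitude_passageComponent,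
      ← Equiv.Perm.iterate_eq_pow, Function.iterate_minimalPeriod] at h
  · have longitude_eq_zero : longitude (D := D) (.inr j) = 0 := by
      simp [longitude, passageComponent]
    change displacement o (longitude (D := D) (.inr j) : D.ReducedAlexanderModule) +ᵥ _ = _
    rw [longitude_eq_zero, Submodule.coe_zero, map_zero, zero_vadd]

theorem exists_arcElement_eq_displacement_vadd {a b : D.Arc}
    (h : arcComponent a = arcComponent b) : ∃ m : D.ReducedAlexanderInvariant,
      arcElement b = displacement o (m : D.ReducedAlexanderModule) +ᵥ arcElement a := by
  rcases a with ⟨⟨p⟩⟩ | i <;> rcases b with ⟨⟨q⟩⟩ | j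
  · obtain ⟨n, rfl⟩ := (passageComponent_eq_iff.mp h).exists_nat_pow_eq
    exact ⟨_, (displacement_sum_passageShift_vadd o p n).symm⟩
  · exact absurd h Sum.inl_ne_inr
  · exact absurd h Sum.inr_ne_inl
  · obtain rfl := Sum.inr_injective h
    exact ⟨0, by simp⟩

end Longitude

end LinkDiagram

/-! ### Almost classical links with two components -/

namespace LinkDiagram

variable {D : LinkDiagram}

theorem IsAlmostClassical.exists_eq_zsmul_longitude (hD : D.IsAlmostClassical)
    (hμ : Nat.card D.Component = 2) {s : D.ReducedAlexanderModule}
    (hs : (1 - T 1 : ℤ[T;T⁻¹]) • s = 0) (i : D.Component) :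
    ∃ k : ℤ, s = (k • longitude i : D.ReducedAlexanderInvariant) := by
  classical
  obtain ⟨j, hji, hj⟩ := (Nat.card_eq_two_iff' i).mp hμ
  have sum_eq_add {f : D.Component → D.ReducedAlexanderInvariant} : ∑ l, f l = f i + f j :=
    Fintype.sum_eq_add i j hji.symm fun l hl => absurd (hj l hl.1) hl.2
  obtain ⟨k, rfl⟩ := exists_eq_sum_zsmul_longitude hs
  have longitude_add : longitude i + longitude j = 0 := sum_eq_add.symm.trans hD.sum_longitude
  refine ⟨k i - k j, congrArg Subtype.val ?_⟩
  rw [sum_eq_add, eq_neg_of_add_eq_zero_right longitude_add]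
  module

theorem IsAlmostClassical.displacement_vadd_arcElement_eq (hD : D.IsAlmostClassical)
    (hμ : Nat.card D.Component = 2) (o : D.MedialQuandle) {s : D.ReducedAlexanderModule}
    (hs : (1 - T 1 : ℤ[T;T⁻¹]) • s = 0) (a : D.Arc) :
    displacement o s +ᵥ arcElement a = arcElement a := by
  obtain ⟨k, rfl⟩ := hD.exists_eq_zsmul_longitude hμ hs (arcComponent a)
  rw [Submodule.coe_smul_of_tower, map_zsmul]
  exact zsmul_mem (K := AddAction.stabilizer (Displacement _ o) (arcElement a))
    (displacement_longitude_vadd o a) k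

theorem IsAlmostClassical.alexanderMap_injective (hD : D.IsAlmostClassical)
    (hμ : Nat.card D.Component = 2) : Function.Injective D.alexanderMap := by
  intro x y hxy
  obtain ⟨a, m, hx⟩ := exists_eq_displacement_vadd_arcElement x x
  obtain ⟨b, n, hy⟩ := exists_eq_displacement_vadd_arcElement x y
  have component_eq : arcComponent a = arcComponent b := by
    have h := congrArg D.componentClass hxy
    rw [hx, hy, componentClass_alexanderMap_displacement_vadd,
      componentClass_alexanderMap_displacement_vadd] at h
    exact (Finsupp.single_left_inj one_ne_zero).mp h
  obtain ⟨l, hb⟩ := exists_arcElement_eq_displacement_vadd x component_eq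
  rw [hb, ← add_vadd, ← map_add, ← Submodule.coe_add] at hy
  have smul_sub_eq_zero : (1 - T 1 : ℤ[T;T⁻¹]) • ((m - (n + l) : D.ReducedAlexanderInvariant) :
      D.ReducedAlexanderModule) = 0 := by
    rw [hx, hy, alexanderMap_displacement_vadd, alexanderMap_displacement_vadd] at hxy
    rw [Submodule.coe_sub, smul_sub, add_left_cancel hxy, sub_self]
  have h_fix := hD.displacement_vadd_arcElement_eq hμ x smul_sub_eq_zero a
  calc
    x = displacement x ((n + l + (m - (n + l)) : D.ReducedAlexanderInvariant) :
        D.ReducedAlexanderModule) +ᵥ arcElement a := by rwa [add_sub_cancel]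
    _ = y := by rw [Submodule.coe_add, map_add, add_vadd, h_fix, ← hy]

theorem alexanderSub_displacement_vadd (o : D.MedialQuandle) (m : D.ReducedAlexanderInvariant)
    (x y : D.MedialQuandle) :
    alexanderSub (displacement o (m : D.ReducedAlexanderModule) +ᵥ x) y =
      alexanderSub x y + (1 - T 1 : ℤ[T;T⁻¹]) • m := by
  ext1
  rw [coe_alexanderSub, alexanderMap_displacement_vadd, Submodule.coe_add, coe_alexanderSub,
    Submodule.coe_smul, add_sub_right_comm]

theorem alexanderSub_self (x : D.MedialQuandle) : alexanderSub x x = 0 := Subtype.ext (sub_self _)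

theorem isAlexanderMap_alexanderSub (y : D.MedialQuandle) :
    IsAlexanderMap fun x => alexanderSub x y :=
  fun x z => Subtype.ext (isAlexanderMap_alexanderMap.sub_const _ x z)

theorem IsAlmostClassical.alexanderSub_injective (hD : D.IsAlmostClassical)
    (hμ : Nat.card D.Component = 2) (y : D.MedialQuandle) :
    Function.Injective fun x => alexanderSub x y :=
  fun _ _ h => hD.alexanderMap_injective hμ (sub_left_injective (congrArg Subtype.val h))

theorem span_alexanderSub (b : D.Arc) : Submodule.span ℤ[T;T⁻¹]
    (Set.range fun a => alexanderSub (arcElement a) (arcElement b)) = ⊤ := by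
  let retract : D.ReducedAlexanderModule →ₗ[ℤ[T;T⁻¹]] D.ReducedAlexanderInvariant :=
    (LinearMap.id - D.reducedCrowellMap.smulRight (arcClass b)).codRestrict _ fun m => by simp
  have coe_retract (m) : (retract m : D.ReducedAlexanderModule) =
      m - D.reducedCrowellMap m • arcClass b := rfl
  have range_eq : (Set.range fun a => alexanderSub (arcElement a) (arcElement b)) =
      retract '' Set.range arcClass := by
    rw [← Set.range_comp]
    exact congrArg Set.range (funext fun a => Subtype.ext (by simp [coe_retract]))
  have retract_surjective : Function.Surjective retract := fun m =>
    ⟨m, Subtype.ext (by simp [coe_retract, LinearMap.mem_ker.mp m.2])⟩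
  rw [range_eq, ← Submodule.map_span, span_arcClass, Submodule.map_top,
    LinearMap.range_eq_top.mpr retract_surjective]

theorem exists_arcComponent_ne (hμ : Nat.card D.Component = 2) :
    ∃ a b : D.Arc, arcComponent a ≠ arcComponent b := by
  obtain ⟨i, j, hij, _⟩ := Nat.card_eq_two_iff.mp hμ
  obtain ⟨a, rfl⟩ := arcComponent_surjective i
  obtain ⟨b, rfl⟩ := arcComponent_surjective j
  exact ⟨a, b, hij⟩

theorem exists_eq_displacement_vadd_or (hμ : Nat.card D.Component = 2) {a b : D.Arc}
    (hab : arcComponent a ≠ arcComponent b) (o x : D.MedialQuandle) :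
    ∃ m : D.ReducedAlexanderInvariant,
      x = displacement o (m : D.ReducedAlexanderModule) +ᵥ arcElement a ∨
        x = displacement o (m : D.ReducedAlexanderModule) +ᵥ arcElement b := by
  obtain ⟨c, m, rfl⟩ := exists_eq_displacement_vadd_arcElement o x
  by_cases hac : arcComponent a = arcComponent c
  · obtain ⟨n, hc⟩ := exists_arcElement_eq_displacement_vadd o hac
    exact ⟨m + n, .inl (by rw [hc, Submodule.coe_add, map_add, add_vadd])⟩
  · have hbc : arcComponent b = arcComponent c :=
      ((Nat.card_eq_two_iff' (arcComponent a)).mp hμ).unique (Ne.symm hab) (Ne.symm hac)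
    obtain ⟨n, hc⟩ := exists_arcElement_eq_displacement_vadd o hbc
    exact ⟨m + n, .inr (by rw [hc, Submodule.coe_add, map_add, add_vadd])⟩

theorem range_alexanderSub (hμ : Nat.card D.Component = 2) {a b : D.Arc}
    (hab : arcComponent a ≠ arcComponent b) :
    (Set.range fun x => alexanderSub x (arcElement b)) =
      {x | ∃ m : D.ReducedAlexanderInvariant, x = (1 - T 1 : ℤ[T;T⁻¹]) • m ∨
        x = alexanderSub (arcElement a) (arcElement b) + (1 - T 1 : ℤ[T;T⁻¹]) • m} := by
  ext y
  constructor
  · rintro ⟨x, rfl⟩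
    obtain ⟨m, h | h⟩ := exists_eq_displacement_vadd_or hμ hab x x
    · exact ⟨m, .inr ((congrArg (alexanderSub · _) h).trans
        (alexanderSub_displacement_vadd _ _ _ _))⟩
    · refine ⟨m, .inl ((congrArg (alexanderSub · _) h).trans ?_)⟩
      rw [alexanderSub_displacement_vadd, alexanderSub_self, zero_add]
  · rintro ⟨m, rfl | rfl⟩
    · exact ⟨displacement (arcElement b) (m : D.ReducedAlexanderModule) +ᵥ arcElement b, by
        simp only [alexanderSub_displacement_vadd, alexanderSub_self, zero_add]⟩
    · exact ⟨_, alexanderSub_displacement_vadd (arcElement b) m _ _⟩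

theorem isFreeGeneratorModOneSubT_alexanderSub (hμ : Nat.card D.Component = 2) {a b : D.Arc}
    (hab : arcComponent a ≠ arcComponent b) :
    IsFreeGeneratorModOneSubT (alexanderSub (arcElement a) (arcElement b)) := by
  refine ⟨fun m => ?_, fun k n h => ?_⟩
  · have m_mem := (span_alexanderSub b).ge (Submodule.mem_top (x := m))
    induction m_mem using Submodule.span_induction with
    | mem _ hm =>
      obtain ⟨c, rfl⟩ := hm
      obtain ⟨n, hn | hn⟩ := (range_alexanderSub hμ hab).le ⟨arcElement c, rfl⟩
      · exact ⟨0, n, by simpa using hn⟩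
      · exact ⟨1, n, by simpa using hn⟩
    | zero => exact ⟨0, 0, by simp⟩
    | add _ _ _ _ h₁ h₂ =>
      obtain ⟨k₁, n₁, rfl⟩ := h₁
      obtain ⟨k₂, n₂, rfl⟩ := h₂
      exact ⟨k₁ + k₂, n₁ + n₂, by module⟩
    | smul p x _ hx =>
      obtain ⟨k, n, hk⟩ := hx
      obtain ⟨l, hl⟩ := exists_eq_augmentation_zsmul_add p x
      refine ⟨augmentation p * k, augmentation p • n + l, ?_⟩
      rw [hl, hk]
      module
  · have componentClass_eq_zero : D.componentClass (k • alexanderSub (arcElement a) (arcElement b) :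
        D.ReducedAlexanderInvariant) = 0 := by
      rw [h]
      exact componentClass_one_sub_T_one_smul _
    simpa [hab.symm] using DFunLike.congr_fun componentClass_eq_zero (arcComponent a)

theorem IsAlmostClassical.exists_bijective_shelfHom {D' : LinkDiagram} (hD : D.IsAlmostClassical)
    (hD' : D'.IsAlmostClassical) (hμ : Nat.card D.Component = 2) (hμ' : Nat.card D'.Component = 2)
    (e : D.ReducedAlexanderInvariant ≃ₗ[ℤ[T;T⁻¹]] D'.ReducedAlexanderInvariant) :
    ∃ f : D.MedialQuandle →◃ D'.MedialQuandle, Function.Bijective f := by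
  obtain ⟨a, b, hab⟩ := exists_arcComponent_ne hμ
  obtain ⟨a', b', hab'⟩ := exists_arcComponent_ne hμ'
  obtain ⟨f, n, hf⟩ :=
    (isFreeGeneratorModOneSubT_alexanderSub hμ hab).exists_linearEquiv_apply_eq_add
      (isFreeGeneratorModOneSubT_alexanderSub hμ' hab') e
  refine exists_bijective_shelfHom_of_image_range_eq (isAlexanderMap_alexanderSub (arcElement b))
    (isAlexanderMap_alexanderSub (arcElement b')) (hD.alexanderSub_injective hμ _)
    (hD'.alexanderSub_injective hμ' _) f ?_
  rw [range_alexanderSub hμ hab, range_alexanderSub hμ' hab', image_setOf_eq_or_eq_add hf]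

end LinkDiagram

theorem mainTheorem3_general (D D' : LinkDiagram)
    (hD : D.IsAlmostClassical) (hD' : D'.IsAlmostClassical)
    (hμ : Nat.card D.Component = 2) (hμ' : Nat.card D'.Component = 2) :
    (∃ f : D.MedialQuandle →◃ D'.MedialQuandle, Function.Bijective f) ↔
      Nonempty (D.ReducedAlexanderInvariant ≃ₗ[ℤ[T;T⁻¹]] D'.ReducedAlexanderInvariant) :=
  ⟨fun ⟨f, hf⟩ => LinkDiagram.nonempty_reducedAlexanderInvariant_equiv f hf,
    fun ⟨e⟩ => hD.exists_bijective_shelfHom hD' hμ hμ' e⟩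

theorem mainTheorem3 (D D' : LinkDiagram)
    (hD : D.IsClassical) (hD' : D'.IsClassical)
    (hμ : Nat.card D.Component = 2) (hμ' : Nat.card D'.Component = 2) :
    (∃ f : D.MedialQuandle →◃ D'.MedialQuandle, Function.Bijective f) ↔
      Nonempty (D.ReducedAlexanderInvariant ≃ₗ[ℤ[T;T⁻¹]] D'.ReducedAlexanderInvariant) :=
  mainTheorem3_general D D' hD.isAlmostClassical hD'.isAlmostClassical hμ hμ'
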